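/- Let $\kappa\in(0,1)$ and let $$K=\int_0^{\pi/2}{}_2F_1\!\left(\tfrac16,\tfrac56;\tfrac12;\kappa^2\sin^2 t\right)dt .$$ There is exactly one Weierstrass function $\wp$ with invariants $g_2=3$ and $g_3=1-2\kappa^2$. Its period lattice is rectangular, that is, equal to $\{2m\omega+2n\,i\omega' : m,n\in\mathbb Z\}$ for some real numbers $\omega,\omega'>0$, and its positive fundamental half-period $\omega$ satisfies $$K=\sqrt{\tfrac32}\;\omega .$$ -/

import Mathlib

noncomputable section

namespace SignatureSix

/-- The incomplete integral `f(T) = ∫₀ᵀ F(1/6, 5/6; 1/2; κ² sin² t) dt` with modulus `κ`. -/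
def f (κ T : ℝ) : ℝ :=
  ∫ t in (0 : ℝ)..T,
    ordinaryHypergeometric (1 / 6 : ℝ) (5 / 6 : ℝ) (1 / 2 : ℝ) (κ ^ 2 * Real.sin t ^ 2)

/-- The complete integral `K = f(π / 2)`. -/
def K (κ : ℝ) : ℝ := f κ (Real.pi / 2)

/-- `p` is a Weierstrass function with invariants `g₂` and `g₃`: it is the `℘`-function of a
lattice `Λ ⊆ ℂ` with `60 ∑ l⁻⁴ = g₂` and `140 ∑ l⁻⁶ = g₃`, the sums over nonzero `l ∈ Λ`.
(The value of `p` at its poles, the points of `Λ`, is `0` by convention.) -/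
def IsWeierstrassFunction (g₂ g₃ : ℂ) (p : ℂ → ℂ) : Prop :=
  ∃ L : PeriodPair, L.g₂ = g₂ ∧ L.g₃ = g₃ ∧ p = L.weierstrassP

/-- The periods of `p` form a rectangular lattice, whose fundamental half-periods are the
positive real number `ω` and the positive imaginary number `i ω'`: the periods of `p` are
exactly the numbers `2 m ω + 2 n i ω'` with integers `m` and `n`. -/
def HasRectangularHalfPeriods (p : ℂ → ℂ) (ω ω' : ℝ) : Prop :=
  0 < ω ∧ 0 < ω' ∧ ∀ w : ℂ, Function.Periodic p w ↔
    ∃ m n : ℤ, w = 2 * (m : ℂ) * (ω : ℂ) + 2 * (n : ℂ) * (Complex.I * (ω' : ℂ))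

end SignatureSix

end

/-! Write m = 1 - 2κ², so |m| < 1, and P(x) = 4x³ - 3x - m.

Value of the integral: `cos_mul_ordinaryHypergeometric_sin_sq` gives F(sin² θ) = cos(2θ/3) / cos θ.
With sin θ = κ sin t and c = cos(2θ/3), the triple-angle formula yields P(c) = 2κ² cos² t, and F dt
becomes -(3/√2) c dc / √((1 - c²) P(c)), a differential of genus 2. The cubic substitution X = (c³ -
m) / (3 (1 - c²)) turns it into a constant multiple of dX / √P(X) (`cubic_map_comp_eq`,
`hasDerivAt_cubic_map`). As t runs from 0 to π/2, X falls from +∞ to ℘(ω). On (0, ω] the function ℘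
also falls from +∞ to ℘(ω), with ℘' = -√P(℘). Comparing the two gives √(2/3) K = ω
(`sqrt_mul_K_eq`).

Uniqueness: the differential equation together with g₃ fixes the Laurent expansion of ℘ at 0, hence
its poles, which form the lattice (`lattice_eq_of_g₂_eq_of_g₃_eq`).

Existence: for the lattice ℤ + itℤ the scale-invariant ratio 3√3 g₃ / g₂^(3/2) tends to 1 as t → ∞,
and t ↦ 1/t changes its sign. The intermediate value theorem reaches m, and rescaling makes g₂ = 3
(`exists_rectangular_invariants`). -/

open Filter Topology
open scoped ComplexConjugate

/-! ### Second-order equations with a regular singular point -/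

/-- The Euler operator `z d/dz` acting on a function of the form `z ^ k * g`. -/
lemma eventually_mul_deriv_pow_mul {h g : ℂ → ℂ} {k : ℕ} (hg : AnalyticAt ℂ g 0)
    (hh : ∀ᶠ z in 𝓝 0, h z = z ^ k * g z) :
    ∀ᶠ z in 𝓝 0, z * deriv h z = z ^ k * (k * g z + z * deriv g z) := by
  have h1 : ∀ᶠ z in 𝓝 0, h =ᶠ[𝓝 z] fun z => z ^ k * g z := hh.eventually_nhds
  filter_upwards [h1, hg.eventually_analyticAt] with z hz hgz
  have hd : HasDerivAt (fun z => z ^ k * g z)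
      (k * z ^ (k - 1) * g z + z ^ k * deriv g z) z :=
    (hasDerivAt_pow k z).mul hgz.differentiableAt.hasDerivAt
  rw [hz.deriv_eq, hd.deriv]
  cases k with
  | zero => simp
  | succ k => simp only [Nat.add_sub_cancel]; ring

/-- The indicial equation of `z² h'' = B h`: a nonzero solution has at `0` an order `k` with
`k (k - 1) = B 0`. -/
lemma eventually_eq_zero_of_euler_ode {h B : ℂ → ℂ} (hh : AnalyticAt ℂ h 0)
    (hB : ContinuousAt B 0)
    (ode : ∀ᶠ z in 𝓝[≠] 0, z ^ 2 * deriv (deriv h) z = B z * h z)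
    (hk : ∀ k : ℕ, (k : ℂ) * (k - 1) = B 0 → iteratedDeriv k h 0 = 0) :
    ∀ᶠ z in 𝓝 0, h z = 0 := by
  by_contra hne
  have hfin : analyticOrderAt h 0 ≠ ⊤ := fun H => hne (analyticOrderAt_eq_top.mp H)
  obtain ⟨k, hk0⟩ := ENat.ne_top_iff_exists.mp hfin
  obtain ⟨g, hg, hg0, hhg⟩ := (hh.analyticOrderAt_eq_natCast).mp hk0.symm
  simp only [sub_zero, smul_eq_mul] at hhg
  have e1 := eventually_mul_deriv_pow_mul hg hhg
  have hg' : AnalyticAt ℂ (fun z => k * g z + z * deriv g z) 0 :=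
    (analyticAt_const.mul hg).add (analyticAt_id.mul hg.deriv)
  have e2 := eventually_mul_deriv_pow_mul hg' e1
  have e3 : ∀ᶠ z in 𝓝 0, deriv (fun z => z * deriv h z) z = deriv h z + z * deriv (deriv h) z := by
    filter_upwards [hh.deriv.eventually_analyticAt] with z hz
    have := (hasDerivAt_id' z).fun_mul hz.differentiableAt.hasDerivAt
    simpa using! this.deriv
  -- With θ = z d/dz one has z² h'' = θ²h - θh, so dividing the equation by z^k leaves `G = 0`. At
  -- the origin this reads (k² - k - B 0) g 0 = 0.
  set G : ℂ → ℂ := fun z => k * (k * g z + z * deriv g z) +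
    z * deriv (fun z => k * g z + z * deriv g z) z - (k * g z + z * deriv g z) - B z * g z with hG
  have hGc : ContinuousAt G 0 := by
    have := hg.continuousAt
    have := hg'.deriv.continuousAt
    have := hg'.continuousAt
    exact (((continuousAt_const.mul hg'.continuousAt).add
      (continuousAt_id.mul hg'.deriv.continuousAt)).sub hg'.continuousAt).sub
      (hB.mul hg.continuousAt)
  have hGz : ∀ᶠ z in 𝓝[≠] 0, G z = 0 := by
    filter_upwards [ode, e1.filter_mono nhdsWithin_le_nhds, e2.filter_mono nhdsWithin_le_nhds,
      e3.filter_mono nhdsWithin_le_nhds, hhg.filter_mono nhdsWithin_le_nhds,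
      self_mem_nhdsWithin] with z h0 h1 h2 h3 h4 hz
    have hz' : z ^ k ≠ 0 := pow_ne_zero _ hz
    rw [h3] at h2
    apply mul_left_cancel₀ hz'
    rw [hG, mul_zero]
    simp only
    rw [h4] at h0
    linear_combination h0 - h2 + h1
  have hG0 : G 0 = 0 := by
    have t1 : Tendsto G (𝓝[≠] 0) (𝓝 (G 0)) := hGc.tendsto.mono_left nhdsWithin_le_nhds
    exact tendsto_nhds_unique t1 ((tendsto_congr' hGz).mpr tendsto_const_nhds)
  have hind : (k : ℂ) * (k - 1) = B 0 := by
    simp only [hG, zero_mul, add_zero] at hG0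
    apply mul_right_cancel₀ hg0
    linear_combination hG0
  exact (((analyticOrderAt_eq_nat_iff_iteratedDeriv_eq_zero hh).mp hk0.symm)).2 (hk k hind)

/-! ### Weierstrass functions: second-order equation, half-periods, dependence on the invariants -/

namespace PeriodPair

variable (L : PeriodPair)

lemma countable_lattice : (L.lattice : Set ℂ).Countable :=
  countable_of_Lindelof_of_discrete (X := L.lattice)

lemma hasDerivAt_weierstrassP {z : ℂ} (hz : z ∉ L.lattice) :
    HasDerivAt L.weierstrassP (L.derivWeierstrassP z) z := by
  rw [← L.deriv_weierstrassP]
  exact (L.analyticOnNhd_weierstrassP z hz).differentiableAt.hasDerivAt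

lemma not_mem_lattice_eventually {z : ℂ} (hz : z ∉ L.lattice) : ∀ᶠ w in 𝓝 z, w ∉ L.lattice :=
  L.isClosed_lattice.isOpen_compl.mem_nhds hz

lemma not_mem_lattice_eventually_nhdsNE (z : ℂ) : ∀ᶠ w in 𝓝[≠] z, w ∉ L.lattice := by
  filter_upwards [nhdsWithin_le_nhds (L.compl_lattice_sdiff_singleton_mem_nhds z),
    self_mem_nhdsWithin] with w h1 h2 h3
  exact h1 ⟨h3, h2⟩

lemma tendsto_sq_mul_weierstrassP :
    Tendsto (fun z => z ^ 2 * L.weierstrassP z) (𝓝[≠] 0) (𝓝 1) := by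
  have h : ContinuousAt (fun z => z ^ 2 * L.weierstrassPExcept 0 z + 1) 0 := by
    have := (L.analyticAt_weierstrassPExcept 0).continuousAt
    fun_prop
  have h1 : Tendsto (fun z => z ^ 2 * L.weierstrassPExcept 0 z + 1) (𝓝[≠] 0) (𝓝 1) := by
    have := h.tendsto.mono_left (nhdsWithin_le_nhds (s := {0}ᶜ))
    simpa using this
  refine h1.congr' ?_
  filter_upwards [self_mem_nhdsWithin] with z hz
  have := L.ite_eq_one_sub_sq_mul_weierstrassP 0 (zero_mem _) z
  rw [if_neg (show z ≠ 0 from hz)] at this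
  simpa using this.symm

lemma tendsto_cube_mul_derivWeierstrassP :
    Tendsto (fun z => z ^ 3 * L.derivWeierstrassP z) (𝓝[≠] 0) (𝓝 (-2)) := by
  have h : ContinuousAt (fun z => z ^ 3 * L.derivWeierstrassPExcept 0 z - 2) 0 := by
    have := (L.analyticAt_derivWeierstrassPExcept 0).continuousAt
    fun_prop
  have h1 : Tendsto (fun z => z ^ 3 * L.derivWeierstrassPExcept 0 z - 2) (𝓝[≠] 0) (𝓝 (-2)) := by
    have := h.tendsto.mono_left (nhdsWithin_le_nhds (s := {0}ᶜ))
    simpa using this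
  refine h1.congr' ?_
  filter_upwards [self_mem_nhdsWithin] with z hz
  have hz : z ≠ 0 := hz
  have := L.derivWeierstrassPExcept_def 0 z
  simp only [ZeroMemClass.coe_zero, sub_zero] at this
  rw [this]
  field_simp
  ring

/-- `℘'' = 6 ℘² - g₂ / 2` -/
lemma deriv_derivWeierstrassP {z : ℂ} (hz : z ∉ L.lattice) :
    deriv L.derivWeierstrassP z = 6 * L.weierstrassP z ^ 2 - L.g₂ / 2 := by
  have hP := L.analyticOnNhd_weierstrassP
  have hP' := L.analyticOnNhd_derivWeierstrassP
  have hconn : IsPreconnected (L.lattice : Set ℂ)ᶜ :=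
    (L.countable_lattice.isConnected_compl_of_one_lt_rank (by simp)).isPreconnected
  -- Differentiating ℘'² = 4℘³ - g₂℘ - g₃ gives the claim multiplied by ℘'. The factor ℘' is
  -- cancelled near one point where it is nonzero, and the identity theorem does the rest.
  have hder : ∀ w ∉ L.lattice,
      L.derivWeierstrassP w * (deriv L.derivWeierstrassP w - (6 * L.weierstrassP w ^ 2 - L.g₂ / 2))
        = 0 := by
    intro w hw
    have d1 := L.hasDerivAt_weierstrassP hw
    have d2 := (hP' w hw).differentiableAt.hasDerivAt
    have e : (fun w => L.derivWeierstrassP w ^ 2) =ᶠ[𝓝 w]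
        fun w => 4 * L.weierstrassP w ^ 3 - L.g₂ * L.weierstrassP w - L.g₃ := by
      filter_upwards [L.not_mem_lattice_eventually hw] with x hx
      exact L.derivWeierstrassP_sq x hx
    have h1 := (d2.fun_pow 2).unique
      ((((((d1.fun_pow 3).const_mul 4).fun_sub (d1.const_mul L.g₂)).sub_const L.g₃)).congr_of_eventuallyEq e)
    norm_num at h1
    linear_combination h1 / 2
  obtain ⟨w, hw1, hw2⟩ : ∃ w, w ∉ L.lattice ∧ L.derivWeierstrassP w ≠ 0 := by
    have h1 : ∀ᶠ w in 𝓝[≠] (0 : ℂ), w ^ 3 * L.derivWeierstrassP w ≠ 0 :=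
      L.tendsto_cube_mul_derivWeierstrassP.eventually_ne (by norm_num)
    obtain ⟨w, hw1, hw2⟩ := (h1.and (L.not_mem_lattice_eventually_nhdsNE 0)).exists
    exact ⟨w, hw2, right_ne_zero_of_mul hw1⟩
  have key : Set.EqOn (fun w => deriv L.derivWeierstrassP w)
      (fun w => 6 * L.weierstrassP w ^ 2 - L.g₂ / 2) (L.lattice : Set ℂ)ᶜ := by
    refine AnalyticOnNhd.eqOn_of_preconnected_of_eventuallyEq hP'.deriv
      (fun x hx => ?_) hconn (z₀ := w) hw1 ?_
    · have := hP x hx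
      fun_prop
    · filter_upwards [L.not_mem_lattice_eventually hw1,
        (hP' w hw1).continuousAt.eventually_ne hw2] with x hx1 hx2
      exact sub_eq_zero.mp ((mul_eq_zero.mp (hder x hx1)).resolve_left hx2)
  exact key hz

/-- If translates of two Weierstrass functions agree near a point, then so do their poles. -/
lemma add_mem_lattice_of_eventuallyEq (L M : PeriodPair) {a b s₀ : ℂ} (ha : s₀ + a ∉ L.lattice)
    (hb : s₀ + b ∉ M.lattice)
    (heq : ∀ᶠ s in 𝓝 s₀, L.weierstrassP (s + a) = M.weierstrassP (s + b)) {s : ℂ}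
    (hs : s + b ∈ M.lattice) : s + a ∈ L.lattice := by
  by_contra hsa
  set A : Set ℂ := (fun s => s + a) ⁻¹' L.lattice with hA
  set B : Set ℂ := (fun s => s + b) ⁻¹' M.lattice with hB
  have hconn : IsPreconnected (A ∪ B)ᶜ :=
    (Set.Countable.isConnected_compl_of_one_lt_rank (by simp)
      ((L.countable_lattice.preimage (add_left_injective a)).union
        (M.countable_lattice.preimage (add_left_injective b)))).isPreconnected
  have key : Set.EqOn (fun s => L.weierstrassP (s + a)) (fun s => M.weierstrassP (s + b))
      (A ∪ B)ᶜ := by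
    refine AnalyticOnNhd.eqOn_of_preconnected_of_eventuallyEq (𝕜 := ℂ) (fun x hx => ?_)
      (fun x hx => ?_) hconn (z₀ := s₀) (by simp [hA, hB, ha, hb]) heq
    · exact AnalyticAt.fun_comp (L.analyticOnNhd_weierstrassP _ fun h => hx (Or.inl h))
        (by fun_prop)
    · exact AnalyticAt.fun_comp (M.analyticOnNhd_weierstrassP _ fun h => hx (Or.inr h))
        (by fun_prop)
  have ht : Tendsto (fun w : ℂ => w - s) (𝓝[≠] s) (𝓝[≠] 0) := by
    refine tendsto_nhdsWithin_iff.mpr ⟨?_, ?_⟩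
    · have : ContinuousAt (fun w : ℂ => w - s) s := by fun_prop
      simpa using this.tendsto.mono_left (nhdsWithin_le_nhds (s := {s}ᶜ))
    · filter_upwards [self_mem_nhdsWithin] with w hw
      simpa [sub_eq_zero] using hw
  have h1 := M.tendsto_sq_mul_weierstrassP.comp ht
  -- If the left function were regular at `s`, multiplying by (w - s)² would give limit 0, whereas
  -- the double pole of the right function gives limit 1.
  have h2 : Tendsto (fun w => (w - s) ^ 2 * L.weierstrassP (w + a)) (𝓝[≠] s) (𝓝 0) := by
    have hc : ContinuousAt (fun w => (w - s) ^ 2 * L.weierstrassP (w + a)) s := by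
      have : ContinuousAt (fun w => L.weierstrassP (w + a)) s :=
        ContinuousAt.comp' (L.analyticOnNhd_weierstrassP _ hsa).continuousAt (by fun_prop)
      fun_prop
    simpa using hc.tendsto.mono_left (nhdsWithin_le_nhds (s := {s}ᶜ))
  refine zero_ne_one (tendsto_nhds_unique h2 (h1.congr' ?_))
  have e1 : ∀ᶠ w in 𝓝 s, w + a ∉ L.lattice :=
    ContinuousAt.tendsto (f := fun w => w + a) (by fun_prop)
      |>.eventually (L.not_mem_lattice_eventually hsa)
  filter_upwards [nhdsWithin_le_nhds e1, ht.eventually (M.not_mem_lattice_eventually_nhdsNE 0)]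
    with w hw1 hw2
  have hper : M.weierstrassP (w - s) = M.weierstrassP (w + b) := by
    rw [← M.weierstrassP_add_coe (w - s) ⟨s + b, hs⟩]
    congr 1
    ring
  have hw3 : w + b ∉ M.lattice := fun h => hw2 (by simpa using sub_mem h hs)
  simp only [Function.comp]
  have hk := key (x := w) (by simp [hA, hB, hw1, hw3])
  simp only at hk
  rw [hper, hk]

/-- A zero of `℘'` is a half-period. -/
lemma two_mul_mem_lattice_of_derivWeierstrassP_eq_zero {z₀ : ℂ} (hz : z₀ ∉ L.lattice)
    (h0 : L.derivWeierstrassP z₀ = 0) : 2 * z₀ ∈ L.lattice := by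
  have hzn : -z₀ ∉ L.lattice := by simpa using hz
  have hneg : ∀ w, L.weierstrassP (z₀ - w) = L.weierstrassP (w - z₀) := fun w => by
    rw [← L.weierstrassP_neg, neg_sub]
  -- Both translates solve y'' = 6y² - g₂/2 with the same value and slope at 0, because ℘ is even
  -- and ℘'(±z₀) = 0. Their difference satisfies a linear equation with exponents 0 and 1, so it
  -- vanishes.
  set h : ℂ → ℂ := fun s => L.weierstrassP (s + z₀) - L.weierstrassP (s - z₀) with hh
  have hA1 : AnalyticAt ℂ (fun s => L.weierstrassP (s + z₀)) 0 :=
    AnalyticAt.fun_comp (by simpa using L.analyticOnNhd_weierstrassP z₀ hz) (by fun_prop)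
  have hA2 : AnalyticAt ℂ (fun s => L.weierstrassP (s - z₀)) 0 :=
    AnalyticAt.fun_comp (by simpa using L.analyticOnNhd_weierstrassP _ hzn) (by fun_prop)
  have hA : AnalyticAt ℂ h 0 := hA1.sub hA2
  have ev1 : ∀ᶠ s in 𝓝 (0 : ℂ), s + z₀ ∉ L.lattice :=
    ContinuousAt.tendsto (f := fun s => s + z₀) (x := 0) (by fun_prop)
      |>.eventually (by simpa using L.not_mem_lattice_eventually hz)
  have ev2 : ∀ᶠ s in 𝓝 (0 : ℂ), s - z₀ ∉ L.lattice :=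
    ContinuousAt.tendsto (f := fun s => s - z₀) (x := 0) (by fun_prop)
      |>.eventually (by simpa using L.not_mem_lattice_eventually hzn)
  have hd1 : deriv h =ᶠ[𝓝 0]
      fun s => L.derivWeierstrassP (s + z₀) - L.derivWeierstrassP (s - z₀) := by
    filter_upwards [ev1, ev2] with s h1 h2
    exact (((L.hasDerivAt_weierstrassP h1).comp_add_const s z₀).sub
      ((L.hasDerivAt_weierstrassP h2).comp_sub_const s z₀)).deriv
  have hd2 : ∀ᶠ s in 𝓝 0, deriv (deriv h) s =
      6 * L.weierstrassP (s + z₀) ^ 2 - 6 * L.weierstrassP (s - z₀) ^ 2 := by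
    filter_upwards [ev1, ev2, hd1.eventually_nhds] with s h1 h2 h3
    rw [EventuallyEq.deriv_eq h3]
    have a1 := (L.analyticOnNhd_derivWeierstrassP _ h1).differentiableAt.hasDerivAt
    have a2 := (L.analyticOnNhd_derivWeierstrassP _ h2).differentiableAt.hasDerivAt
    rw [((a1.comp_add_const s z₀).fun_sub (a2.comp_sub_const s z₀)).deriv,
      L.deriv_derivWeierstrassP h1, L.deriv_derivWeierstrassP h2]
    ring
  have hzero := eventually_eq_zero_of_euler_ode (h := h)
    (B := fun s => s ^ 2 * (6 * (L.weierstrassP (s + z₀) + L.weierstrassP (s - z₀)))) hA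
    (by have := hA1.continuousAt; have := hA2.continuousAt; fun_prop)
    (by
      filter_upwards [hd2.filter_mono nhdsWithin_le_nhds] with s hs
      rw [hs, hh]; ring)
    (by
      intro k hk
      have hk : (k : ℂ) = 0 ∨ (k : ℂ) = 1 := by
        simpa [sub_eq_zero] using hk
      rcases hk with hk | hk
      · obtain rfl : k = 0 := by exact_mod_cast hk
        simp [hh]
      · obtain rfl : k = 1 := by exact_mod_cast hk
        rw [iteratedDeriv_one, hd1.self_of_nhds]
        simp [h0])
  -- The pole of ℘(s - z₀) at s = z₀ must be a pole of ℘(s + z₀), located at 2z₀.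
  have := add_mem_lattice_of_eventuallyEq L L (a := z₀) (b := -z₀) (s₀ := 0) (s := z₀)
    (by simpa using hz) (by simpa using hz) (by
      filter_upwards [hzero] with s hs
      exact sub_eq_zero.mp hs) (by simp)
  rwa [two_mul]

lemma periodic_weierstrassP_iff {w : ℂ} :
    Function.Periodic L.weierstrassP w ↔ w ∈ L.lattice := by
  refine ⟨fun h => ?_, fun h => L.periodic_weierstrassP ⟨w, h⟩⟩
  by_contra hw
  refine L.not_continuousAt_weierstrassP 0 (zero_mem _) ?_
  have hc : ContinuousAt (fun z => L.weierstrassP (z + w)) 0 :=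
    ContinuousAt.comp' (by simpa using (L.analyticOnNhd_weierstrassP _ hw).continuousAt)
      (by fun_prop)
  exact hc.congr (.of_forall h)

/-- Since g₂ is shared, the difference h of the two functions satisfies h'' = 6(℘_L + ℘_M)h. Both
have principal part s⁻², so s² times the coefficient is 12 at the origin, and k(k - 1) = 12 leaves
only order k = 4. The fourth Taylor coefficient is a multiple of the weight-6 sum, so equality of g₃
removes it. -/
lemma lattice_le_of_g₂_eq_of_g₃_eq {L M : PeriodPair} (h2 : L.g₂ = M.g₂) (h3 : L.g₃ = M.g₃) :
    M.lattice ≤ L.lattice := by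
  set h : ℂ → ℂ := fun s => L.weierstrassPExcept 0 s - M.weierstrassPExcept 0 s with hh
  have hLA := L.analyticAt_weierstrassPExcept 0
  have hMA := M.analyticAt_weierstrassPExcept 0
  have hA : AnalyticAt ℂ h 0 := hLA.sub hMA
  have hne : ∀ᶠ s in 𝓝[≠] (0 : ℂ), s ≠ 0 ∧ s ∉ L.lattice ∧ s ∉ M.lattice := by
    filter_upwards [L.not_mem_lattice_eventually_nhdsNE 0, M.not_mem_lattice_eventually_nhdsNE 0,
      self_mem_nhdsWithin] with s h1 h2 h3 using ⟨h3, h1, h2⟩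
  have hdiff : ∀ s, h s = L.weierstrassP s - M.weierstrassP s := by
    intro s
    have e1 := L.weierstrassPExcept_def 0 s
    have e2 := M.weierstrassPExcept_def 0 s
    simp only [ZeroMemClass.coe_zero] at e1 e2
    rw [hh]
    simp only
    rw [e1, e2]
    ring
  have hdiff' : h = fun s => L.weierstrassP s - M.weierstrassP s := funext hdiff
  have hd2 : ∀ᶠ s in 𝓝[≠] 0, deriv (deriv h) s =
      6 * L.weierstrassP s ^ 2 - 6 * M.weierstrassP s ^ 2 := by
    filter_upwards [hne] with s ⟨_, hL, hM⟩
    have h3 : deriv h =ᶠ[𝓝 s] fun s => L.derivWeierstrassP s - M.derivWeierstrassP s := by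
      filter_upwards [L.not_mem_lattice_eventually hL, M.not_mem_lattice_eventually hM]
        with t t1 t2
      rw [hdiff']
      exact ((L.hasDerivAt_weierstrassP t1).fun_sub (M.hasDerivAt_weierstrassP t2)).deriv
    rw [EventuallyEq.deriv_eq h3]
    have a1 := (L.analyticOnNhd_derivWeierstrassP _ hL).differentiableAt.hasDerivAt
    have a2 := (M.analyticOnNhd_derivWeierstrassP _ hM).differentiableAt.hasDerivAt
    rw [(a1.fun_sub a2).deriv, L.deriv_derivWeierstrassP hL, M.deriv_derivWeierstrassP hM, h2]
    ring
  have hzero := eventually_eq_zero_of_euler_ode (h := h)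
    (B := fun s => 12 + 6 * s ^ 2 * (L.weierstrassPExcept 0 s + M.weierstrassPExcept 0 s)) hA
    (by have := hLA.continuousAt; have := hMA.continuousAt; fun_prop)
    (by
      filter_upwards [hd2, hne] with s hs ⟨h0, _, _⟩
      have e1 := L.weierstrassPExcept_def 0 s
      have e2 := M.weierstrassPExcept_def 0 s
      simp only [ZeroMemClass.coe_zero] at e1 e2
      rw [hs, hdiff, e1, e2]
      field_simp
      ring)
    (by
      intro k hk
      have hk : (k : ℂ) * (k - 1) = 12 := by simpa using hk
      have hk : k = 4 := by
        have : (k : ℝ) * (k - 1) = 12 := by exact_mod_cast congrArg Complex.re hk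
        have h4 : ((k : ℝ) - 4) * (k + 3) = 0 := by linear_combination this
        have h5 : (k : ℝ) - 4 = 0 := (mul_eq_zero.mp h4).resolve_right (by positivity)
        exact_mod_cast sub_eq_zero.mp h5
      subst hk
      have hG : L.G 6 = M.G 6 := by
        simpa [g₃] using h3
      rw [hh, iteratedDeriv_fun_sub hLA.contDiffAt hMA.contDiffAt,
        L.iteratedDeriv_weierstrassPExcept_self, M.iteratedDeriv_weierstrassPExcept_self]
      simp [hG])
  obtain ⟨s₀, hs, _, hL, hM⟩ :=
    ((hzero.eventually_nhds.filter_mono nhdsWithin_le_nhds).and hne).exists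
  intro s hs'
  have := add_mem_lattice_of_eventuallyEq L M (a := 0) (b := 0) (s₀ := s₀) (s := s)
    (by simpa using hL) (by simpa using hM) (by
      filter_upwards [hs] with s hs
      rw [hdiff] at hs
      simpa [sub_eq_zero] using hs) (by simpa using hs')
  simpa using this

/-- The invariants `g₂` and `g₃` determine the lattice. -/
lemma lattice_eq_of_g₂_eq_of_g₃_eq {L M : PeriodPair} (h2 : L.g₂ = M.g₂) (h3 : L.g₃ = M.g₃) :
    L.lattice = M.lattice :=
  le_antisymm (lattice_le_of_g₂_eq_of_g₃_eq h2.symm h3.symm) (lattice_le_of_g₂_eq_of_g₃_eq h2 h3)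

lemma weierstrassP_eq_of_lattice_eq {L M : PeriodPair} (h : L.lattice = M.lattice) :
    L.weierstrassP = M.weierstrassP := by
  ext z
  simp only [weierstrassP]
  rw [h]

lemma G_eq_of_lattice_eq {L M : PeriodPair} (h : L.lattice = M.lattice) : L.G = M.G := by
  ext z
  simp only [G]
  rw [h]

end PeriodPair

/-! ### Rectangular lattices: reality, signs and monotonicity -/

namespace PeriodPair

/-- The pair of periods `2ω`, `2iω'`, for positive real numbers `ω` and `ω'`. -/
@[simps ω₁ ω₂]
def rectangular (ω ω' : ℝ) (hω : 0 < ω) (hω' : 0 < ω') : PeriodPair where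
  ω₁ := 2 * ω
  ω₂ := 2 * (Complex.I * ω')
  indep := by
    rw [LinearIndependent.pair_iff]
    intro s t h
    have h1 := congrArg Complex.re h
    have h2 := congrArg Complex.im h
    simp at h1 h2
    exact ⟨h1.resolve_right hω.ne', h2.resolve_right hω'.ne'⟩

section Rectangular

variable {ω ω' : ℝ} (hω : 0 < ω) (hω' : 0 < ω')

lemma mem_lattice_rectangular {z : ℂ} :
    z ∈ (rectangular ω ω' hω hω').lattice ↔
      ∃ m n : ℤ, z.re = 2 * m * ω ∧ z.im = 2 * n * ω' := by
  rw [mem_lattice]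
  refine exists₂_congr fun m n => ?_
  rw [Complex.ext_iff]
  simp only [rectangular_ω₁, rectangular_ω₂]
  simp
  constructor
  · rintro ⟨h1, h2⟩; exact ⟨by rw [← h1]; ring, by rw [← h2]; ring⟩
  · rintro ⟨h1, h2⟩; exact ⟨by rw [h1]; ring, by rw [h2]; ring⟩

lemma conj_mem_lattice_rectangular {z : ℂ} (hz : z ∈ (rectangular ω ω' hω hω').lattice) :
    conj z ∈ (rectangular ω ω' hω hω').lattice := by
  rw [mem_lattice_rectangular] at hz ⊢
  obtain ⟨m, n, h1, h2⟩ := hz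
  exact ⟨m, -n, by simpa using h1, by simp [h2]⟩

/-- Complex conjugation as a permutation of a rectangular lattice. -/
def conjEquivRectangular :
    (rectangular ω ω' hω hω').lattice ≃ (rectangular ω ω' hω hω').lattice where
  toFun l := ⟨conj l.1, conj_mem_lattice_rectangular hω hω' l.2⟩
  invFun l := ⟨conj l.1, conj_mem_lattice_rectangular hω hω' l.2⟩
  left_inv l := by simp
  right_inv l := by simp

lemma coe_conjEquivRectangular (l : (rectangular ω ω' hω hω').lattice) :
    (conjEquivRectangular hω hω' l : ℂ) = conj (l : ℂ) := rfl

lemma weierstrassP_rectangular_conj (z : ℂ) :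
    (rectangular ω ω' hω hω').weierstrassP (conj z) =
      conj ((rectangular ω ω' hω hω').weierstrassP z) := by
  rw [weierstrassP, weierstrassP, Complex.conj_tsum,
    ← (conjEquivRectangular hω hω').tsum_eq]
  congr with l
  simp [coe_conjEquivRectangular]

lemma derivWeierstrassP_rectangular_conj (z : ℂ) :
    (rectangular ω ω' hω hω').derivWeierstrassP (conj z) =
      conj ((rectangular ω ω' hω hω').derivWeierstrassP z) := by
  rw [derivWeierstrassP, derivWeierstrassP, map_neg, Complex.conj_tsum,
    ← (conjEquivRectangular hω hω').tsum_eq]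
  congr with l
  simp [coe_conjEquivRectangular, Complex.conj_ofNat]

lemma conj_G_rectangular (n : ℕ) :
    conj ((rectangular ω ω' hω hω').G n) = (rectangular ω ω' hω hω').G n := by
  rw [G, Complex.conj_tsum, ← (conjEquivRectangular hω hω').tsum_eq]
  congr with l
  simp [coe_conjEquivRectangular]

lemma ofReal_re_G_rectangular (n : ℕ) :
    (((rectangular ω ω' hω hω').G n).re : ℂ) = (rectangular ω ω' hω hω').G n :=
  Complex.conj_eq_iff_re.mp (conj_G_rectangular hω hω' n)

lemma ofReal_re_weierstrassP_rectangular (x : ℝ) :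
    (((rectangular ω ω' hω hω').weierstrassP x).re : ℂ) =
      (rectangular ω ω' hω hω').weierstrassP x :=
  Complex.conj_eq_iff_re.mp (by rw [← weierstrassP_rectangular_conj, Complex.conj_ofReal])

lemma ofReal_re_derivWeierstrassP_rectangular (x : ℝ) :
    (((rectangular ω ω' hω hω').derivWeierstrassP x).re : ℂ) =
      (rectangular ω ω' hω hω').derivWeierstrassP x :=
  Complex.conj_eq_iff_re.mp (by rw [← derivWeierstrassP_rectangular_conj, Complex.conj_ofReal])

lemma not_mem_lattice_rectangular_of_re {z : ℂ} (h0 : 0 < z.re) (h1 : z.re < 2 * ω) :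
    z ∉ (rectangular ω ω' hω hω').lattice := by
  rw [mem_lattice_rectangular]
  rintro ⟨m, n, h, -⟩
  rw [h] at h0 h1
  have h2 : (0 : ℝ) < m := by
    by_contra! hm
    nlinarith
  have h3 : (m : ℝ) < 1 := by
    by_contra! hm
    nlinarith
  norm_cast at h2 h3
  omega

lemma not_mem_lattice_rectangular_of_im {z : ℂ} (h0 : 0 < z.im) (h1 : z.im < 2 * ω') :
    z ∉ (rectangular ω ω' hω hω').lattice := by
  rw [mem_lattice_rectangular]
  rintro ⟨m, n, -, h⟩
  rw [h] at h0 h1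
  have h2 : (0 : ℝ) < n := by
    by_contra! hm
    nlinarith
  have h3 : (n : ℝ) < 1 := by
    by_contra! hm
    nlinarith
  norm_cast at h2 h3
  omega

/-- `℘'` vanishes at half-periods. -/
lemma derivWeierstrassP_eq_zero_of_two_mul_mem (L : PeriodPair) {z : ℂ} (hz : 2 * z ∈ L.lattice) :
    L.derivWeierstrassP z = 0 := by
  have h := L.derivWeierstrassP_add_coe (-z) ⟨2 * z, hz⟩
  rw [L.derivWeierstrassP_neg] at h
  rw [← CharZero.eq_neg_self_iff, ← h]
  congr 1
  simp only
  ring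

lemma ofReal_re_weierstrassP_rectangular_add (s : ℝ) :
    (((rectangular ω ω' hω hω').weierstrassP (ω + Complex.I * s)).re : ℂ) =
      (rectangular ω ω' hω hω').weierstrassP (ω + Complex.I * s) := by
  refine Complex.conj_eq_iff_re.mp ?_
  rw [← weierstrassP_rectangular_conj, ← weierstrassP_neg]
  have h := (rectangular ω ω' hω hω').weierstrassP_add_coe (-conj (ω + Complex.I * s))
    ⟨_, (rectangular ω ω' hω hω').ω₁_mem_lattice⟩
  rw [← h]
  congr 1
  simp
  ring

/-- Rolle's theorem on the segment from ω to ω + iω': ℘' vanishes at both half-periods, so ℘'' = 6℘²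
- g₂/2 vanishes in between, where ℘ is real. This shows g₂ ≥ 0. -/
lemma exists_weierstrassP_sq_eq :
    ∃ s ∈ Set.Ioo 0 ω', 12 * ((rectangular ω ω' hω hω').weierstrassP (ω + Complex.I * s)).re ^ 2 =
      (rectangular ω ω' hω hω').g₂.re := by
  set L := rectangular ω ω' hω hω' with hL
  have hmem : ∀ s : ℝ, (ω + Complex.I * s : ℂ) ∉ L.lattice := fun s =>
    not_mem_lattice_rectangular_of_re hω hω' (by simpa) (by simp; linarith)
  have hd : ∀ s : ℝ, HasDerivAt
      (fun s : ℝ => (Complex.I * L.derivWeierstrassP (ω + Complex.I * s)).re)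
      (L.g₂.re / 2 - 6 * (L.weierstrassP (ω + Complex.I * s)).re ^ 2) s := by
    intro s
    have h1 : HasDerivAt L.derivWeierstrassP _ (ω + Complex.I * s) :=
      (L.analyticOnNhd_derivWeierstrassP _ (hmem s)).differentiableAt.hasDerivAt
    rw [L.deriv_derivWeierstrassP (hmem s)] at h1
    have h2 : HasDerivAt (fun z : ℂ => (ω : ℂ) + Complex.I * z) Complex.I (s : ℂ) := by
      simpa using ((hasDerivAt_id (s : ℂ)).const_mul Complex.I).const_add (ω : ℂ)
    have h3 := ((HasDerivAt.comp (s : ℂ) h1 h2).const_mul Complex.I).real_of_complex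
    convert! h3 using 1
    rw [← ofReal_re_weierstrassP_rectangular_add hω hω' s, ← hL]
    generalize (L.weierstrassP (ω + Complex.I * s)).re = w
    have : Complex.I * ((6 * (w : ℂ) ^ 2 - L.g₂ / 2) * Complex.I) = L.g₂ / 2 - (6 * w ^ 2 : ℝ) := by
      push_cast
      linear_combination (6 * (w : ℂ) ^ 2 - L.g₂ / 2) * Complex.I_mul_I
    rw [this, Complex.sub_re, Complex.ofReal_re]
    simp
  obtain ⟨s, hs, hs0⟩ := exists_hasDerivAt_eq_zero hω'
    (fun s _ => (hd s).continuousAt.continuousWithinAt) (by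
      rw [derivWeierstrassP_eq_zero_of_two_mul_mem L, derivWeierstrassP_eq_zero_of_two_mul_mem L]
      · rw [hL, mem_lattice_rectangular]; exact ⟨1, 1, by simp, by simp⟩
      · rw [hL, mem_lattice_rectangular]; exact ⟨1, 0, by simp, by simp⟩) (fun s _ => hd s)
  exact ⟨s, hs, by linarith⟩

lemma re_g₂_rectangular_nonneg : 0 ≤ (rectangular ω ω' hω hω').g₂.re := by
  obtain ⟨s, -, h⟩ := exists_weierstrassP_sq_eq hω hω'
  rw [← h]
  positivity

lemma ofReal_re_g₂_rectangular :
    ((rectangular ω ω' hω hω').g₂.re : ℂ) = (rectangular ω ω' hω hω').g₂ := by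
  rw [g₂, ← ofReal_re_G_rectangular]
  norm_cast

lemma ofReal_re_g₃_rectangular :
    ((rectangular ω ω' hω hω').g₃.re : ℂ) = (rectangular ω ω' hω hω').g₃ := by
  rw [g₃, ← ofReal_re_G_rectangular]
  norm_cast

/-- If both invariants vanished, the Rolle point would have ℘ = 0, hence ℘' = 0, and would be a
half-period. It lies strictly between two adjacent ones. -/
lemma g₂_rectangular_ne_zero_or :
    (rectangular ω ω' hω hω').g₂.re ≠ 0 ∨ (rectangular ω ω' hω hω').g₃.re ≠ 0 := by
  by_contra! hcon
  obtain ⟨h2, h3⟩ := hcon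
  obtain ⟨s, hs, h⟩ := exists_weierstrassP_sq_eq hω hω'
  have hw : ((rectangular ω ω' hω hω').weierstrassP (ω + Complex.I * s)).re = 0 := by
    rw [h2] at h
    simpa using h
  have hmem : (ω + Complex.I * s : ℂ) ∉ (rectangular ω ω' hω hω').lattice :=
    not_mem_lattice_rectangular_of_re hω hω' (by simpa) (by simp; linarith)
  have hsq := (rectangular ω ω' hω hω').derivWeierstrassP_sq _ hmem
  rw [← ofReal_re_weierstrassP_rectangular_add, hw, ← ofReal_re_g₃_rectangular, h3] at hsq
  have h0 := (rectangular ω ω' hω hω').two_mul_mem_lattice_of_derivWeierstrassP_eq_zero hmem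
    (by simpa using hsq)
  exact not_mem_lattice_rectangular_of_im hω hω' (by simpa using hs.1)
    (by simpa using hs.2) h0

lemma hasDerivAt_re_weierstrassP_rectangular {x : ℝ} (h0 : 0 < x) (h1 : x < 2 * ω) :
    HasDerivAt (fun x : ℝ => ((rectangular ω ω' hω hω').weierstrassP x).re)
      ((rectangular ω ω' hω hω').derivWeierstrassP x).re x :=
  (hasDerivAt_weierstrassP _ (not_mem_lattice_rectangular_of_re hω hω'
    (by simpa) (by simpa))).real_of_complex

lemma re_derivWeierstrassP_rectangular_sq {x : ℝ} (h0 : 0 < x) (h1 : x < 2 * ω) :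
    ((rectangular ω ω' hω hω').derivWeierstrassP x).re ^ 2 =
      4 * ((rectangular ω ω' hω hω').weierstrassP x).re ^ 3
        - (rectangular ω ω' hω hω').g₂.re * ((rectangular ω ω' hω hω').weierstrassP x).re
        - (rectangular ω ω' hω hω').g₃.re := by
  have h := (rectangular ω ω' hω hω').derivWeierstrassP_sq x
    (not_mem_lattice_rectangular_of_re hω hω' (by simpa) (by simpa))
  rw [← ofReal_re_weierstrassP_rectangular, ← ofReal_re_derivWeierstrassP_rectangular,
    ← ofReal_re_g₃_rectangular, ← ofReal_re_g₂_rectangular] at h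
  exact_mod_cast h

lemma tendsto_ofReal_nhdsGT_nhdsNE : Tendsto (fun x : ℝ => (x : ℂ)) (𝓝[>] 0) (𝓝[≠] 0) := by
  refine tendsto_nhdsWithin_iff.mpr ⟨?_, ?_⟩
  · simpa using Complex.continuous_ofReal.continuousAt.tendsto.mono_left
      (nhdsWithin_le_nhds (a := (0 : ℝ)) (s := Set.Ioi 0))
  · filter_upwards [self_mem_nhdsWithin] with x hx
    simpa using (Set.mem_Ioi.mp hx).ne'

lemma tendsto_re_weierstrassP_rectangular :
    Tendsto (fun x : ℝ => ((rectangular ω ω' hω hω').weierstrassP x).re) (𝓝[>] 0) atTop := by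
  have h1 := (Complex.continuous_re.tendsto _).comp
    ((rectangular ω ω' hω hω').tendsto_sq_mul_weierstrassP.comp tendsto_ofReal_nhdsGT_nhdsNE)
  have h2 : Tendsto (fun x : ℝ => (x ^ 2)⁻¹) (𝓝[>] 0) atTop := by
    have := (tendsto_pow_atTop (α := ℝ) two_ne_zero).comp (tendsto_inv_nhdsGT_zero (𝕜 := ℝ))
    simpa [Function.comp_def] using this
  refine (h2.atTop_mul_pos (by simp) h1).congr' ?_
  filter_upwards [self_mem_nhdsWithin] with x hx
  have hx : x ≠ 0 := (Set.mem_Ioi.mp hx).ne'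
  simp only [Function.comp]
  rw [← Complex.ofReal_pow, Complex.re_ofReal_mul]
  field_simp

/-- A zero of ℘' in (0, ω) would be a half-period, which is impossible there. Hence ℘' keeps the
sign of its leading term -2/x³ at 0. -/
lemma re_derivWeierstrassP_rectangular_neg {x : ℝ} (h0 : 0 < x) (h1 : x < ω) :
    ((rectangular ω ω' hω hω').derivWeierstrassP x).re < 0 := by
  set L := rectangular ω ω' hω hω' with hL
  have hne : ∀ x : ℝ, 0 < x → x < ω → (L.derivWeierstrassP x).re ≠ 0 := by
    intro x h0 h1 h
    have hmem : (x : ℂ) ∉ L.lattice :=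
      not_mem_lattice_rectangular_of_re hω hω' (by simpa) (by simp; linarith)
    have h2 := L.two_mul_mem_lattice_of_derivWeierstrassP_eq_zero hmem (by
      rw [← ofReal_re_derivWeierstrassP_rectangular, ← hL, h, Complex.ofReal_zero])
    exact not_mem_lattice_rectangular_of_re hω hω' (by simpa) (by simpa) h2
  have hcont : ContinuousOn (fun x : ℝ => (L.derivWeierstrassP x).re) (Set.Ioo 0 ω) := by
    intro x hx
    have hmem : (x : ℂ) ∉ L.lattice := not_mem_lattice_rectangular_of_re hω hω'
      (by simpa using hx.1) (by simp; linarith [hx.2])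
    exact (L.analyticOnNhd_derivWeierstrassP _ hmem).differentiableAt.hasDerivAt.real_of_complex
      |>.continuousAt.continuousWithinAt
  obtain ⟨a, ha, ha0⟩ : ∃ a ∈ Set.Ioo 0 ω, (L.derivWeierstrassP a).re < 0 := by
    have h1 := (Complex.continuous_re.tendsto _).comp
      (L.tendsto_cube_mul_derivWeierstrassP.comp tendsto_ofReal_nhdsGT_nhdsNE)
    have h2 := h1.eventually_lt_const (u := 0) (by simp)
    obtain ⟨a, h, ha⟩ := (h2.and (Ioo_mem_nhdsGT hω)).exists
    refine ⟨a, ha, ?_⟩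
    simp only [Function.comp] at h
    rw [← Complex.ofReal_pow, Complex.re_ofReal_mul] at h
    exact neg_of_mul_neg_right h (pow_pos ha.1 3).le
  by_contra! hx
  obtain ⟨c, hc, hc0⟩ := isPreconnected_Ioo.intermediate_value ha ⟨h0, h1⟩ hcont ⟨ha0.le, hx⟩
  exact hne c hc.1 hc.2 hc0

lemma re_derivWeierstrassP_rectangular_half :
    ((rectangular ω ω' hω hω').derivWeierstrassP ω).re = 0 := by
  rw [derivWeierstrassP_eq_zero_of_two_mul_mem, Complex.zero_re]
  rw [mem_lattice_rectangular]
  exact ⟨1, 0, by simp, by simp⟩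

end Rectangular

end PeriodPair

/-! ### Eisenstein sums of ℤ + itℤ and existence of the lattice -/

namespace PeriodPair

/-- The Eisenstein sum of weight `n` for the lattice spanned by `1` and `it`. -/
noncomputable def imagEisenstein (n : ℕ) (t : ℝ) : ℂ :=
  ∑' p : ℤ × ℤ, ((p.1 + p.2 * (Complex.I * t) : ℂ) ^ n)⁻¹

lemma G_rectangular_eq {s t : ℝ} (hs : 0 < s) (ht : 0 < t) (n : ℕ) :
    (rectangular (s / 2) (s * t / 2) (by positivity) (by positivity)).G n =
      ((s : ℂ) ^ n)⁻¹ * imagEisenstein n t := by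
  rw [G, ← (latticeEquivProd _).symm.toEquiv.tsum_eq, imagEisenstein, ← tsum_mul_left]
  refine tsum_congr fun p => ?_
  rw [← mul_inv, ← mul_pow]
  congr 2
  simp [latticeEquiv_symm_apply]
  ring

lemma summable_imagEisenstein_one {n : ℕ} (hn : 2 < n) :
    Summable fun p : ℤ × ℤ => (‖(p.1 + p.2 * Complex.I : ℂ)‖ ^ n)⁻¹ := by
  set L := rectangular (1 / 2) (1 / 2) (by norm_num) (by norm_num) with hL
  have h := ZLattice.summable_norm_pow_inv L.lattice n (by simpa using hn)
  rw [← L.latticeEquivProd.symm.toEquiv.summable_iff] at h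
  convert! h using 1
  ext p
  simp [latticeEquiv_symm_apply, hL]
  ring_nf

/-- Comparison with the square lattice, uniform in t ≥ c. It supplies the summable majorant for
continuity in t and for the limit t → ∞. -/
lemma mul_norm_add_mul_I_le {c t : ℝ} (hc0 : 0 ≤ c) (hc1 : c ≤ 1) (hct : c ≤ t) (p : ℤ × ℤ) :
    c * ‖(p.1 + p.2 * Complex.I : ℂ)‖ ≤ ‖(p.1 + p.2 * (Complex.I * t) : ℂ)‖ := by
  refine le_of_sq_le_sq ?_ (norm_nonneg _)
  rw [mul_pow, Complex.sq_norm, Complex.sq_norm, Complex.normSq_apply, Complex.normSq_apply]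
  simp only [Complex.add_re, Complex.add_im, Complex.mul_re, Complex.mul_im, Complex.intCast_re,
    Complex.intCast_im, Complex.I_re, Complex.I_im, Complex.ofReal_re, Complex.ofReal_im]
  have h1 : c ^ 2 * (p.1 : ℝ) ^ 2 ≤ 1 ^ 2 * (p.1 : ℝ) ^ 2 := by gcongr
  have h2 : c ^ 2 * (p.2 : ℝ) ^ 2 ≤ t ^ 2 * (p.2 : ℝ) ^ 2 := by gcongr
  ring_nf at h1 h2 ⊢
  linarith

lemma norm_inv_pow_le {c t : ℝ} (hc0 : 0 < c) (hc1 : c ≤ 1) (hct : c ≤ t) (n : ℕ) (p : ℤ × ℤ) :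
    ‖((p.1 + p.2 * (Complex.I * t) : ℂ) ^ n)⁻¹‖ ≤
      (c ^ n)⁻¹ * (‖(p.1 + p.2 * Complex.I : ℂ)‖ ^ n)⁻¹ := by
  rcases eq_or_ne p 0 with rfl | hp
  · rcases eq_or_ne n 0 with rfl | hn <;> simp [*]
  rw [norm_inv, norm_pow, ← mul_inv, ← mul_pow]
  have h := mul_norm_add_mul_I_le hc0.le hc1 hct p
  have h0 : (p.1 + p.2 * Complex.I : ℂ) ≠ 0 := by
    intro h0
    have h1 := congrArg Complex.re h0
    have h2 := congrArg Complex.im h0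
    simp at h1 h2
    exact hp (Prod.ext h1 h2)
  have : 0 < ‖(p.1 + p.2 * Complex.I : ℂ)‖ := norm_pos_iff.mpr h0
  gcongr

lemma continuousOn_imagEisenstein {n : ℕ} (hn : 2 < n) :
    ContinuousOn (imagEisenstein n) (Set.Ioi 0) := by
  intro t ht
  have ht : 0 < t := ht
  set c := min 1 (t / 2) with hc
  have hc0 : 0 < c := lt_min one_pos (by positivity)
  have h : ContinuousOn (imagEisenstein n) (Set.Ici c) := by
    refine continuousOn_tsum (fun p => ?_) ((summable_imagEisenstein_one hn).mul_left (c ^ n)⁻¹)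
      fun p x hx => norm_inv_pow_le hc0 (min_le_left _ _) hx n p
    rcases eq_or_ne p 0 with rfl | hp
    · simp [continuousOn_const]
    refine ContinuousOn.inv₀ (by fun_prop) fun x hx h0 => hp ?_
    have hx : x ≠ 0 := (hc0.trans_le hx).ne'
    have h0 := eq_zero_of_pow_eq_zero h0
    have h1 := congrArg Complex.re h0
    have h2 := congrArg Complex.im h0
    simp [hx] at h1 h2
    exact Prod.ext h1 h2
  exact (h.continuousAt (Ici_mem_nhds ((min_le_right _ _).trans_lt (by linarith)))).continuousWithinAt

/-- Every term off the row `p.2 = 0` tends to 0, and dominated convergence leaves that row alone. -/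
lemma tendsto_imagEisenstein {n : ℕ} (hn : 2 < n) :
    Tendsto (imagEisenstein n) atTop (𝓝 (∑' m : ℤ, ((m : ℂ) ^ n)⁻¹)) := by
  have hlim : ∑' p : ℤ × ℤ, (if p.2 = 0 then ((p.1 : ℂ) ^ n)⁻¹ else 0) =
      ∑' m : ℤ, ((m : ℂ) ^ n)⁻¹ := by
    have hi : Function.Injective (fun m : ℤ => ((m, 0) : ℤ × ℤ)) := fun a b h => by simpa using h
    rw [← hi.tsum_eq]
    · simp
    · intro p hp
      have : p.2 = 0 := by
        by_contra h
        simp [h] at hp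
      exact ⟨p.1, by ext <;> simp [this]⟩
  rw [← hlim]
  refine tendsto_tsum_of_dominated_convergence (summable_imagEisenstein_one hn) (fun p => ?_) ?_
  · split_ifs with h
    · simp [h]
    · refine Filter.tendsto_inv₀_cobounded.comp ?_
      refine (tendsto_pow_cobounded_cobounded (by omega : n ≠ 0)).comp ?_
      rw [← tendsto_norm_atTop_iff_cobounded]
      have hp : (0 : ℝ) < |(p.2 : ℝ)| := by positivity
      refine tendsto_atTop_mono' _ ?_ (tendsto_id.const_mul_atTop hp)
      filter_upwards [eventually_ge_atTop 0] with t ht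
      refine le_trans (le_of_eq ?_) (Complex.abs_im_le_norm _)
      simp [abs_mul, abs_of_nonneg ht]
  · filter_upwards [eventually_ge_atTop 1] with t ht p
    simpa using norm_inv_pow_le one_pos le_rfl ht n p

lemma imagEisenstein_inv {t : ℝ} (ht : 0 < t) (n : ℕ) :
    imagEisenstein n t⁻¹ = (-Complex.I * t) ^ n * imagEisenstein n t := by
  have ht' : (t : ℂ) ≠ 0 := by exact_mod_cast ht.ne'
  -- The reindexing (p, q) ↦ (-q, p) rests on -q + p·i/t = (i/t)(p + q·it).
  let e : ℤ × ℤ ≃ ℤ × ℤ := (Equiv.prodComm ℤ ℤ).trans ((Equiv.neg ℤ).prodCongr (Equiv.refl ℤ))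
  rw [imagEisenstein, imagEisenstein, ← tsum_mul_left, ← e.tsum_eq]
  refine tsum_congr fun p => ?_
  have h1 : (-Complex.I * t)⁻¹ = Complex.I / t := by
    rw [mul_inv, inv_neg, Complex.inv_I]; ring
  rw [← inv_inv ((-Complex.I * t) ^ n), ← mul_inv, ← inv_pow (-Complex.I * t), h1, ← mul_pow]
  congr 2
  simp [e]
  field_simp
  linear_combination (-(p.2 : ℂ) * t) * Complex.I_sq

lemma tsum_int_inv_pow {n : ℕ} (hn : Even n) (hn0 : n ≠ 0) {a : ℝ}
    (h : HasSum (fun k : ℕ => 1 / (k : ℝ) ^ n) a) :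
    ∑' m : ℤ, ((m : ℂ) ^ n)⁻¹ = (2 * a : ℝ) := by
  have h1 : HasSum (fun m : ℤ => ((m : ℝ) ^ n)⁻¹) (a + a) := by
    refine HasSum.of_nat_of_neg_add_one (by simpa using h) ?_
    have := (hasSum_nat_add_iff' 1).mpr h
    simp [hn0] at this
    convert! this using 2 with k
    push_cast
    rw [hn.neg_pow]
  have h2 := (Complex.hasSum_ofReal.mpr h1).tsum_eq
  push_cast at h2
  rw [h2]
  push_cast
  ring

lemma hasSum_zeta_six : HasSum (fun k : ℕ => 1 / (k : ℝ) ^ 6) (Real.pi ^ 6 / 945) := by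
  have hb : bernoulli 6 = 1 / 42 := by
    rw [bernoulli_eq_bernoulli'_of_ne_one (by decide)]
    have h5 : bernoulli' 5 = 0 := by
      rw [bernoulli'_def]
      norm_num [Finset.sum_range_succ, Nat.choose]
    rw [bernoulli'_def]
    norm_num [Finset.sum_range_succ, h5, Nat.choose]
  have := hasSum_zeta_nat (k := 3) (by decide)
  convert! this using 1
  norm_num [hb, Nat.factorial]
  ring

/-- Every pair of invariants `g₂ = 3`, `g₃ = m ∈ (-1, 1)` comes from a rectangular lattice. -/
lemma exists_rectangular_invariants {m : ℝ} (hm : |m| < 1) :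
    ∃ (ω ω' : ℝ) (hω : 0 < ω) (hω' : 0 < ω'),
      (rectangular ω ω' hω hω').g₂ = 3 ∧ (rectangular ω ω' hω hω').g₃ = m := by
  set a : ℝ → ℝ := fun t => 60 * (imagEisenstein 4 t).re with ha
  set b : ℝ → ℝ := fun t => 140 * (imagEisenstein 6 t).re with hb
  have hE : ∀ n, ∀ t > 0, ((imagEisenstein n t).re : ℂ) = imagEisenstein n t := by
    intro n t ht
    have h := G_rectangular_eq one_pos ht n
    simp only [Complex.ofReal_one, one_pow, inv_one, one_mul] at h
    rw [← h, ofReal_re_G_rectangular]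
  have ha0 : ∀ t > 0, 0 ≤ a t := by
    intro t ht
    have h := re_g₂_rectangular_nonneg (ω := 1 / 2) (ω' := 1 * t / 2) (by norm_num) (by positivity)
    rw [g₂, G_rectangular_eq one_pos ht] at h
    simpa [ha] using h
  have hab : ∀ t > 0, a t ≠ 0 ∨ b t ≠ 0 := by
    intro t ht
    have h := g₂_rectangular_ne_zero_or (ω := 1 / 2) (ω' := 1 * t / 2) (by norm_num) (by positivity)
    rw [g₂, g₃, G_rectangular_eq one_pos ht, G_rectangular_eq one_pos ht] at h
    simpa [ha, hb] using h
  have hainv : ∀ t > 0, a t⁻¹ = t ^ 4 * a t := by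
    intro t ht
    simp only [ha]
    rw [imagEisenstein_inv ht, mul_pow, Even.neg_pow (by decide), Complex.I_pow_four, one_mul,
      ← Complex.ofReal_pow, Complex.re_ofReal_mul]
    ring
  have hbinv : ∀ t > 0, b t⁻¹ = -(t ^ 6 * b t) := by
    intro t ht
    simp only [hb]
    have : Complex.I ^ 6 = -1 := by
      rw [show 6 = 4 + 2 from rfl, pow_add, Complex.I_pow_four, Complex.I_sq, one_mul]
    rw [imagEisenstein_inv ht, mul_pow, Even.neg_pow (by decide), this, neg_one_mul, neg_mul,
      Complex.neg_re, ← Complex.ofReal_pow, Complex.re_ofReal_mul]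
    ring
  have halim : Tendsto a atTop (𝓝 (4 * Real.pi ^ 4 / 3)) := by
    have h := (Complex.continuous_re.tendsto _).comp (tendsto_imagEisenstein (n := 4) (by norm_num))
    rw [tsum_int_inv_pow (by decide) (by norm_num) hasSum_zeta_four, Complex.ofReal_re] at h
    convert! h.const_mul 60 using 2
    ring
  have hblim : Tendsto b atTop (𝓝 (8 * Real.pi ^ 6 / 27)) := by
    have h := (Complex.continuous_re.tendsto _).comp (tendsto_imagEisenstein (n := 6) (by norm_num))
    rw [tsum_int_inv_pow (by decide) (by norm_num) hasSum_zeta_six, Complex.ofReal_re] at h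
    convert! h.const_mul 140 using 2
    ring
  have h3 : √3 * √3 = (3 : ℝ) := Real.mul_self_sqrt (by norm_num)
  have hs3 : (0 : ℝ) < √3 := by positivity
  -- Both `b` and a^(3/2) have weight 6, so `φ m t = 0` does not depend on the scale of the lattice.
  -- It holds for g₂ = 3, g₃ = m because 3^(3/2) = 3√3.
  set φ : ℝ → ℝ → ℝ := fun μ t => b t - μ / (3 * √3) * (a t * √(a t)) with hφ
  have hpos : ∀ μ < 1, ∀ᶠ t in atTop, 0 < φ μ t := by
    intro μ hμ
    have hl := hblim.sub ((halim.mul halim.sqrt).const_mul (μ / (3 * √3)))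
    have hsq : √(4 * Real.pi ^ 4 / 3) = 2 * Real.pi ^ 2 / √3 := by
      rw [Real.sqrt_eq_iff_mul_self_eq (by positivity) (by positivity)]
      field_simp
      linear_combination (4 : ℝ) * h3
    rw [hsq] at hl
    refine hl.eventually_const_lt ?_
    have : 8 * Real.pi ^ 6 / 27 -
        μ / (3 * √3) * (4 * Real.pi ^ 4 / 3 * (2 * Real.pi ^ 2 / √3)) =
        8 * Real.pi ^ 6 / 27 * (1 - μ) := by
      field_simp
      rw [Real.sq_sqrt (by norm_num)]
      ring
    rw [this]
    have : 0 < 1 - μ := by linarith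
    positivity
  -- The value at 1/T is governed by `φ (-m) T`, so positivity at infinity for both m and -m gives a
  -- sign change of `φ m`.
  have hflip : ∀ t > 0, φ m t⁻¹ = -(t ^ 6 * φ (-m) t) := by
    intro t ht
    have : √(t ^ 4 * a t) = t ^ 2 * √(a t) := by
      rw [show t ^ 4 = (t ^ 2) ^ 2 by ring, Real.sqrt_mul (by positivity),
        Real.sqrt_sq (by positivity)]
    simp only [hφ]
    rw [hainv t ht, hbinv t ht, this]
    ring
  obtain ⟨T, ⟨hT1, hT2⟩, hT3⟩ := (((hpos m (abs_lt.mp hm).2).and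
    (hpos (-m) (by linarith [(abs_lt.mp hm).1]))).and (eventually_gt_atTop 1)).exists
  have hT0 : 0 < T := by linarith
  have hcont : ContinuousOn (φ m) (Set.Ioi 0) := by
    have c1 : ContinuousOn a (Set.Ioi 0) := continuousOn_const.mul
      (Complex.continuous_re.comp_continuousOn (continuousOn_imagEisenstein (by norm_num)))
    have c2 : ContinuousOn b (Set.Ioi 0) := continuousOn_const.mul
      (Complex.continuous_re.comp_continuousOn (continuousOn_imagEisenstein (by norm_num)))
    exact c2.sub (continuousOn_const.mul (c1.mul c1.sqrt))
  obtain ⟨t, ht, hφt⟩ := isPreconnected_Ioi.intermediate_value (s := Set.Ioi (0 : ℝ))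
    (Set.mem_Ioi.mpr (inv_pos.mpr hT0)) (Set.mem_Ioi.mpr hT0) hcont
    (show (0 : ℝ) ∈ Set.Icc (φ m T⁻¹) (φ m T) by
      rw [hflip T hT0]
      exact ⟨by have := mul_pos (pow_pos hT0 6) hT2; linarith, hT1.le⟩)
  have ht : 0 < t := ht
  have hbt : b t = m / (3 * √3) * (a t * √(a t)) := sub_eq_zero.mp hφt
  have hat : 0 < a t := by
    refine (ha0 t ht).lt_of_ne' fun h => (hab t ht).elim (fun h' => h' h) fun h' => h' ?_
    rw [hbt, h]; simp
  -- Scaling the lattice by s divides g₂ by s⁴ and g₃ by s⁶, and s⁴ = a(t)/3 makes g₂ = 3.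
  set s : ℝ := √(√(a t / 3)) with hs
  have hs0 : 0 < s := by positivity
  have hs2 : s ^ 2 = √(a t) / √3 := by
    rw [hs, Real.sq_sqrt (by positivity), Real.sqrt_div' _ (by norm_num)]
  have hs4 : s ^ 4 = a t / 3 := by
    rw [show s ^ 4 = (s ^ 2) ^ 2 by ring, hs2, div_pow, Real.sq_sqrt hat.le,
      Real.sq_sqrt (by norm_num)]
  have hs6 : m * s ^ 6 = b t := by
    rw [show s ^ 6 = s ^ 4 * s ^ 2 by ring, hs2, hs4, hbt]
    field_simp
  refine ⟨s / 2, s * t / 2, by positivity, by positivity, ?_, ?_⟩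
  · rw [g₂, G_rectangular_eq hs0 ht, ← hE 4 t ht]
    have : s ^ 4 * 3 = 60 * (imagEisenstein 4 t).re := by rw [hs4]; simp [ha]
    have hs' : (s : ℂ) ≠ 0 := by exact_mod_cast hs0.ne'
    field_simp
    exact_mod_cast this.symm
  · rw [g₃, G_rectangular_eq hs0 ht, ← hE 6 t ht]
    have : s ^ 6 * m = 140 * (imagEisenstein 6 t).re := by rw [mul_comm, hs6]
    have hs' : (s : ℂ) ≠ 0 := by exact_mod_cast hs0.ne'
    field_simp
    exact_mod_cast this.symm

end PeriodPair

/-! ### Closed form of the hypergeometric function -/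

lemma HasFPowerSeriesOnBall.deriv_ofScalars {f : ℝ → ℝ} {c : ℕ → ℝ} {r : ENNReal}
    (h : HasFPowerSeriesOnBall f (FormalMultilinearSeries.ofScalars ℝ c) 0 r) :
    HasFPowerSeriesOnBall (deriv f)
      (FormalMultilinearSeries.ofScalars ℝ fun n => (n + 1 : ℝ) * c (n + 1)) 0 r := by
  convert! (ContinuousLinearMap.apply ℝ ℝ (1 : ℝ)).comp_hasFPowerSeriesOnBall h.fderiv using 1
  ext n
  simp

/-- The hypergeometric differential equation satisfied by a power series whose coefficients obey
the hypergeometric recurrence. -/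
lemma hypergeometric_ode {F : ℝ → ℝ} {c : ℕ → ℝ} {a b d : ℝ}
    (h : HasFPowerSeriesOnBall F (FormalMultilinearSeries.ofScalars ℝ c) 0 1)
    (hc : ∀ n : ℕ, (n + 1) * (n + d) * c (n + 1) = (n + a) * (n + b) * c n)
    {x : ℝ} (hx : |x| < 1) :
    x * (1 - x) * deriv (deriv F) x + (d - (a + b + 1) * x) * deriv F x - a * b * F x = 0 := by
  have hxb : x ∈ Metric.eball (0 : ℝ) 1 := by
    rw [Metric.mem_eball, edist_zero_right, ← ofReal_norm]
    simpa using hx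
  have s0 := h.hasSum hxb
  have s1 := h.deriv_ofScalars.hasSum hxb
  have s2 := h.deriv_ofScalars.deriv_ofScalars.hasSum hxb
  simp only [FormalMultilinearSeries.ofScalars_apply_eq, smul_eq_mul, zero_add] at s0 s1 s2
  have s1x : HasSum (fun n : ℕ => n * c n * x ^ n) (x * deriv F x) := by
    rw [← hasSum_nat_add_iff' 1]
    simp only [Finset.range_one, Finset.sum_singleton, Nat.cast_zero, zero_mul, sub_zero]
    convert! s1.mul_left x using 2 with n
    push_cast; ring
  have s2x : HasSum (fun n : ℕ => n * (n + 1) * c (n + 1) * x ^ n) (x * deriv (deriv F) x) := by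
    rw [← hasSum_nat_add_iff' 1]
    simp only [Finset.range_one, Finset.sum_singleton, Nat.cast_zero, zero_mul, sub_zero]
    convert! s2.mul_left x using 2 with n
    push_cast; ring
  have s2xx : HasSum (fun n : ℕ => n * (n - 1) * c n * x ^ n) (x ^ 2 * deriv (deriv F) x) := by
    rw [← hasSum_nat_add_iff' 2]
    simp only [Finset.sum_range_succ, Finset.range_zero, Finset.sum_empty, Nat.cast_zero,
      Nat.cast_one, sub_self, mul_zero, zero_mul, add_zero, sub_zero]
    convert! s2.mul_left (x ^ 2) using 2 with n
    push_cast; ring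
  have key := ((((s2x.sub s2xx).add (s1.mul_left d)).sub (s1x.mul_left (a + b + 1))).sub
    (s0.mul_left (a * b)))
  have hz : ∀ n : ℕ, (n * (n + 1) * c (n + 1) * x ^ n - n * (n - 1) * c n * x ^ n +
      d * ((n + 1) * c (n + 1) * x ^ n) - (a + b + 1) * (n * c n * x ^ n) -
      a * b * (c n * x ^ n) : ℝ) = 0 := fun n => by
    linear_combination x ^ n * hc n
  have := key.unique (by simpa only [hz] using! hasSum_zero)
  linear_combination this

lemma hasFPowerSeriesOnBall_ordinaryHypergeometric :
    HasFPowerSeriesOnBall (ordinaryHypergeometric (1 / 6 : ℝ) (5 / 6 : ℝ) (1 / 2 : ℝ) : ℝ → ℝ)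
      (FormalMultilinearSeries.ofScalars ℝ
        (ordinaryHypergeometricCoefficient (1 / 6 : ℝ) (5 / 6 : ℝ) (1 / 2 : ℝ))) 0 1 := by
  have hr : (ordinaryHypergeometricSeries ℝ (1 / 6 : ℝ) (5 / 6 : ℝ) (1 / 2 : ℝ)).radius = 1 := by
    refine ordinaryHypergeometricSeries_radius_eq_one _ _ _ _ fun k => ?_
    have : (0 : ℝ) ≤ k := k.cast_nonneg
    refine ⟨?_, ?_, ?_⟩ <;> · intro h; linarith
  have := (ordinaryHypergeometricSeries ℝ (1 / 6 : ℝ) (5 / 6 : ℝ) (1 / 2 : ℝ)).hasFPowerSeriesOnBall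
    (by rw [hr]; exact one_pos)
  rwa [hr] at this

lemma ordinaryHypergeometricCoefficient_succ (a b : ℝ) {c : ℝ} (hc : 0 < c) (n : ℕ) :
    (n + 1) * (n + c) * ordinaryHypergeometricCoefficient a b c (n + 1) =
      (n + a) * (n + b) * ordinaryHypergeometricCoefficient a b c n := by
  have h1 : (0 : ℝ) < (ascPochhammer ℝ n).eval c := ascPochhammer_pos n c hc
  have h2 : (0 : ℝ) < c + n := by positivity
  simp only [ordinaryHypergeometricCoefficient, ascPochhammer_succ_eval, Nat.factorial_succ,
    Nat.cast_mul, Nat.cast_succ]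
  have h3 : (n.factorial : ℝ) ≠ 0 := by positivity
  field_simp
  ring

/-- `₂F₁(1/6, 5/6; 1/2; sin² z) = cos (2 z / 3) / cos z`. -/
lemma cos_mul_ordinaryHypergeometric_sin_sq {z : ℝ} (hz : z ∈ Set.Ioo (-(Real.pi / 2)) (Real.pi / 2)) :
    Real.cos z * ordinaryHypergeometric (1 / 6 : ℝ) (5 / 6 : ℝ) (1 / 2 : ℝ) (Real.sin z ^ 2) =
      Real.cos (2 * z / 3) := by
  set F : ℝ → ℝ := ordinaryHypergeometric (1 / 6 : ℝ) (5 / 6 : ℝ) (1 / 2 : ℝ) with hF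
  have hps := hasFPowerSeriesOnBall_ordinaryHypergeometric
  rw [← hF] at hps
  have hball : ∀ z ∈ Set.Ioo (-(Real.pi / 2)) (Real.pi / 2), |Real.sin z ^ 2| < 1 := by
    intro z hz
    have := Real.cos_pos_of_mem_Ioo hz
    rw [abs_of_nonneg (sq_nonneg _), Real.sin_sq]
    have : 0 < Real.cos z ^ 2 := by positivity
    linarith
  have hball' : ∀ z ∈ Set.Ioo (-(Real.pi / 2)) (Real.pi / 2),
      Real.sin z ^ 2 ∈ Metric.eball (0 : ℝ) 1 := fun z hz => by
    rw [Metric.mem_eball, edist_zero_right, ← ofReal_norm]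
    simpa using hball z hz
  have hF1 : ∀ z ∈ Set.Ioo (-(Real.pi / 2)) (Real.pi / 2),
      HasDerivAt F (deriv F (Real.sin z ^ 2)) (Real.sin z ^ 2) := fun z hz =>
    (hps.analyticAt_of_mem (hball' z hz)).differentiableAt.hasDerivAt
  have hF2 : ∀ z ∈ Set.Ioo (-(Real.pi / 2)) (Real.pi / 2),
      HasDerivAt (deriv F) (deriv (deriv F) (Real.sin z ^ 2)) (Real.sin z ^ 2) := fun z hz =>
    (hps.analyticAt_of_mem (hball' z hz)).deriv.differentiableAt.hasDerivAt
  have hsin : ∀ z, HasDerivAt (fun z => Real.sin z ^ 2) (2 * Real.sin z * Real.cos z) z := fun z => by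
    simpa using (Real.hasDerivAt_sin z).fun_pow 2
  -- In the variable z the hypergeometric equation becomes g'' = -(4/9) g with g(0) = 1 and g'(0) =
  -- 0; `h` is g' written out.
  set g : ℝ → ℝ := fun z => Real.cos z * F (Real.sin z ^ 2) with hg
  set h : ℝ → ℝ := fun z => -Real.sin z * F (Real.sin z ^ 2) +
    2 * Real.sin z * Real.cos z ^ 2 * deriv F (Real.sin z ^ 2) with hh
  have dg : ∀ z ∈ Set.Ioo (-(Real.pi / 2)) (Real.pi / 2), HasDerivAt g (h z) z := by
    intro z hz
    convert! (Real.hasDerivAt_cos z).fun_mul ((hF1 z hz).comp z (hsin z)) using 1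
    simp only [hh, Function.comp]
    ring
  have dh : ∀ z ∈ Set.Ioo (-(Real.pi / 2)) (Real.pi / 2), HasDerivAt h (-(4 / 9) * g z) z := by
    intro z hz
    have e1 := (Real.hasDerivAt_sin z).fun_neg.fun_mul ((hF1 z hz).comp z (hsin z))
    have e2 := (((Real.hasDerivAt_sin z).const_mul 2).fun_mul
      ((Real.hasDerivAt_cos z).fun_pow 2)).fun_mul ((hF2 z hz).comp z (hsin z))
    convert! e1.fun_add e2 using 1
    have ode := hypergeometric_ode hps
      (ordinaryHypergeometricCoefficient_succ _ _ (by norm_num)) (hball z hz)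
    have hcs := Real.sin_sq_add_cos_sq z
    have hcs' : Real.sin z ^ 2 = 1 - Real.cos z ^ 2 := by linarith
    simp only [hg, Function.comp]
    norm_num
    norm_num at ode
    generalize deriv (deriv F) (Real.sin z ^ 2) = F2 at *
    generalize deriv F (Real.sin z ^ 2) = F1 at *
    generalize F (Real.sin z ^ 2) = F0 at *
    rw [hcs'] at ode
    linear_combination (-4 * Real.cos z) * ode + (6 * Real.cos z * F1 - 4 * Real.cos z ^ 3 * F2) * hcs
  have hk : ∀ z : ℝ, HasDerivAt (fun z : ℝ => 2 * z / 3) (2 / 3) z := fun z => by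
    simpa using ((hasDerivAt_id z).const_mul 2).div_const 3
  -- The energy of the difference g - cos(2z/3) is conserved and vanishes at 0.
  set W : ℝ → ℝ := fun z => (h z + 2 / 3 * Real.sin (2 * z / 3)) ^ 2 +
    4 / 9 * (g z - Real.cos (2 * z / 3)) ^ 2 with hW
  have dW : ∀ z ∈ Set.Ioo (-(Real.pi / 2)) (Real.pi / 2), HasDerivAt W 0 z := by
    intro z hz
    have e1 := ((dh z hz).fun_add (((hk z).sin).const_mul (2 / 3))).fun_pow 2
    have e2 := (((dg z hz).fun_sub ((hk z).cos)).fun_pow 2).const_mul (4 / 9)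
    convert! e1.fun_add e2 using 1
    norm_num
    ring
  have h0 : (0 : ℝ) ∈ Set.Ioo (-(Real.pi / 2)) (Real.pi / 2) := by
    constructor <;> linarith [Real.pi_pos]
  have hW0 : W z = W 0 := isOpen_Ioo.is_const_of_deriv_eq_zero isPreconnected_Ioo
    (fun z hz => (dW z hz).differentiableAt.differentiableWithinAt) (fun z hz => (dW z hz).deriv) hz h0
  have hW00 : W 0 = 0 := by simp [hW, hg, hh, hF]
  rw [hW00] at hW0
  have h1 : 4 / 9 * (g z - Real.cos (2 * z / 3)) ^ 2 = 0 := by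
    apply le_antisymm _ (by positivity)
    rw [← hW0]
    simp only [hW]
    linarith [sq_nonneg (h z + 2 / 3 * Real.sin (2 * z / 3))]
  have h2 : g z - Real.cos (2 * z / 3) = 0 := by simpa using h1
  exact sub_eq_zero.mp h2

/-! ### Inversion of ℘ on the real axis and the cubic substitution -/

/-- Inverse of a function on `(0, ω]` that decreases from `+∞`. -/
lemma exists_inverse_of_deriv_neg {y v : ℝ → ℝ} {ω : ℝ} (hω : 0 < ω)
    (hd : ∀ x ∈ Set.Ioc 0 ω, HasDerivAt y (v x) x) (hv : ∀ x ∈ Set.Ioo 0 ω, v x < 0)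
    (hlim : Tendsto y (𝓝[>] 0) atTop) :
    ∃ I : ℝ → ℝ, (∀ X, y ω < X → I X ∈ Set.Ioo 0 ω ∧ y (I X) = X ∧ HasDerivAt I (v (I X))⁻¹ X) ∧
      Tendsto I atTop (𝓝 0) ∧ Tendsto I (𝓝[>] (y ω)) (𝓝 ω) := by
  have hcont : ContinuousOn y (Set.Ioc 0 ω) := fun x hx =>
    (hd x hx).continuousAt.continuousWithinAt
  have hanti : StrictAntiOn y (Set.Ioc 0 ω) := by
    refine strictAntiOn_of_deriv_neg (convex_Ioc 0 ω) hcont fun x hx => ?_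
    rw [interior_Ioc] at hx
    rw [(hd x ⟨hx.1, hx.2.le⟩).deriv]
    exact hv x hx
  have hex : ∀ X, ∃ x, y ω < X → x ∈ Set.Ioo 0 ω ∧ y x = X := by
    intro X
    by_cases hX : y ω < X
    · obtain ⟨a, ha1, ha⟩ := ((hlim.eventually_gt_atTop X).and (Ioo_mem_nhdsGT hω)).exists
      obtain ⟨x, hx, hxX⟩ := intermediate_value_Icc' ha.2.le
        (hcont.mono fun z hz => ⟨ha.1.trans_le hz.1, hz.2⟩) ⟨hX.le, ha1.le⟩
      refine ⟨x, fun _ => ⟨⟨ha.1.trans_le hx.1, hx.2.lt_of_ne ?_⟩, hxX⟩⟩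
      rintro rfl
      exact hX.ne hxX
    · exact ⟨0, fun h => absurd h hX⟩
  choose I hI using hex
  have hIy : ∀ x ∈ Set.Ioo 0 ω, y ω < y x ∧ I (y x) = x := by
    intro x hx
    have h := hanti ⟨hx.1, hx.2.le⟩ ⟨hω, le_rfl⟩ hx.2
    obtain ⟨h1, h2⟩ := hI (y x) h
    exact ⟨h, hanti.injOn ⟨h1.1, h1.2.le⟩ ⟨hx.1, hx.2.le⟩ h2⟩
  have hlt : ∀ X, y ω < X → ∀ x ∈ Set.Ioo 0 ω, (I X < x ↔ y x < X) := by
    intro X hX x hx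
    obtain ⟨h1, h2⟩ := hI X hX
    conv_rhs => rw [← h2]
    exact (hanti.lt_iff_gt ⟨hx.1, hx.2.le⟩ ⟨h1.1, h1.2.le⟩).symm
  have hgt : ∀ X, y ω < X → ∀ x ∈ Set.Ioo 0 ω, (x < I X ↔ X < y x) := by
    intro X hX x hx
    obtain ⟨h1, h2⟩ := hI X hX
    conv_rhs => rw [← h2]
    exact (hanti.lt_iff_gt ⟨h1.1, h1.2.le⟩ ⟨hx.1, hx.2.le⟩).symm
  have hIc : ∀ X, y ω < X → ContinuousAt I X := by
    intro X hX
    -- A strictly monotone function whose image is a neighbourhood of its value is continuous there;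
    -- the sign turns the decreasing `I` into an increasing function.
    have hmono : StrictMonoOn (fun X => -I X) (Set.Ioi (y ω)) := by
      intro A hA B hB hAB
      refine neg_lt_neg ((hlt B hB _ (hI A hA).1).mpr ?_)
      rwa [(hI A hA).2]
    have hJ : ContinuousAt (fun X => -I X) X := by
      refine hmono.continuousAt_of_image_mem_nhds (Ioi_mem_nhds hX) ?_
      refine mem_of_superset (Ioo_mem_nhds (neg_lt_neg (hI X hX).1.2)
        (neg_lt_zero.mpr (hI X hX).1.1)) fun z hz => ?_
      have hz' : -z ∈ Set.Ioo 0 ω := ⟨by linarith [hz.2], by linarith [hz.1]⟩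
      refine ⟨y (-z), (hIy _ hz').1, ?_⟩
      simp only
      rw [(hIy _ hz').2, neg_neg]
    simpa only [neg_neg] using hJ.fun_neg
  refine ⟨I, fun X hX => ⟨(hI X hX).1, (hI X hX).2, ?_⟩, ?_, ?_⟩
  · have hm := (hI X hX).1
    refine (hd _ ⟨hm.1, hm.2.le⟩).of_local_left_inverse (hIc X hX) (hv _ hm).ne ?_
    filter_upwards [Ioi_mem_nhds hX] with Z hZ using (hI Z hZ).2
  · refine tendsto_order.mpr ⟨fun a ha => ?_, fun a ha => ?_⟩
    · filter_upwards [eventually_gt_atTop (y ω)] with X hX using ha.trans (hI X hX).1.1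
    · have hx : min a (ω / 2) ∈ Set.Ioo 0 ω :=
        ⟨lt_min ha (by positivity), (min_le_right _ _).trans_lt (by linarith)⟩
      filter_upwards [eventually_gt_atTop (y ω), eventually_gt_atTop (y (min a (ω / 2)))]
        with X h1 h2
      exact ((hlt X h1 _ hx).mpr h2).trans_le (min_le_left _ _)
  · refine tendsto_order.mpr ⟨fun a ha => ?_, fun a ha => ?_⟩
    · have hx : max a (ω / 2) ∈ Set.Ioo 0 ω :=
        ⟨lt_max_of_lt_right (by positivity), max_lt ha (by linarith)⟩
      filter_upwards [Ioo_mem_nhdsGT (hIy _ hx).1] with X hX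
      exact (le_max_left _ _).trans_lt ((hgt X hX.1 _ hx).mpr hX.2)
    · filter_upwards [self_mem_nhdsWithin] with X hX using (hI X hX).1.2.trans ha

/-- The cubic map `x = (c³ - m) / (3 (1 - c²))` carries `4 x³ - 3 x - m` to
`(4 c³ - 3 c - m) (c³ - 3 c + 2 m)² / (27 (1 - c²)³)`. -/
lemma cubic_map_comp_eq {c m : ℝ} (hc : 1 - c ^ 2 ≠ 0) :
    4 * ((c ^ 3 - m) / (3 * (1 - c ^ 2))) ^ 3 - 3 * ((c ^ 3 - m) / (3 * (1 - c ^ 2))) - m =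
      (4 * c ^ 3 - 3 * c - m) * (c ^ 3 - 3 * c + 2 * m) ^ 2 / (27 * (1 - c ^ 2) ^ 3) := by
  field_simp
  ring

/-- When P(e) = 0, c³ + 3ec² - 3e - m equals (c - e)(c + 2e)². This form shows that the map fixes
the root e and that c > e gives X > e when c² < 1 and c + 2e ≠ 0. -/
lemma cubic_map_eq_root_add {c e m : ℝ} (hc : 1 - c ^ 2 ≠ 0) (he : 4 * e ^ 3 - 3 * e - m = 0) :
    (c ^ 3 - m) / (3 * (1 - c ^ 2)) = e + (c - e) * (c + 2 * e) ^ 2 / (3 * (1 - c ^ 2)) := by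
  field_simp
  linear_combination he

lemma hasDerivAt_cubic_map {c m : ℝ} (hc : 1 - c ^ 2 ≠ 0) :
    HasDerivAt (fun c => (c ^ 3 - m) / (3 * (1 - c ^ 2)))
      (-(c * (c ^ 3 - 3 * c + 2 * m)) / (3 * (1 - c ^ 2) ^ 2)) c := by
  have h1 : HasDerivAt (fun c : ℝ => c ^ 3 - m) (3 * c ^ 2) c := by
    simpa using (hasDerivAt_pow 3 c).sub_const m
  have h2 : HasDerivAt (fun c : ℝ => 3 * (1 - c ^ 2)) (3 * (-(2 * c))) c := by
    simpa using ((hasDerivAt_pow 2 c).const_sub 1).const_mul 3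
  convert! h1.fun_div h2 (by simpa using hc) using 1
  field_simp
  ring

/-! ### The amplitude cos(2θ/3) and evaluation of K -/

namespace SignatureSix

/-- The amplitude `cos (2 θ / 3)` where `sin θ = κ sin t`. -/
noncomputable def cosTwoThirds (κ t : ℝ) : ℝ := Real.cos (2 * Real.arcsin (κ * Real.sin t) / 3)

lemma abs_mul_sin_lt {κ : ℝ} (hκ0 : 0 < κ) (hκ1 : κ < 1) (t : ℝ) : |κ * Real.sin t| < 1 := by
  rw [abs_mul, abs_of_pos hκ0]
  exact (mul_le_of_le_one_right hκ0.le (Real.abs_sin_le_one t)).trans_lt hκ1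

lemma arcsin_mem {κ : ℝ} (hκ0 : 0 < κ) (hκ1 : κ < 1) (t : ℝ) :
    Real.arcsin (κ * Real.sin t) ∈ Set.Ioo (-(Real.pi / 2)) (Real.pi / 2) := by
  have h := abs_lt.mp (abs_mul_sin_lt hκ0 hκ1 t)
  exact ⟨Real.neg_pi_div_two_lt_arcsin.mpr h.1, Real.arcsin_lt_pi_div_two.mpr h.2⟩

lemma sin_arcsin_mul_sin {κ : ℝ} (hκ0 : 0 < κ) (hκ1 : κ < 1) (t : ℝ) : Real.sin (Real.arcsin (κ * Real.sin t)) = κ * Real.sin t := by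
  have h := abs_lt.mp (abs_mul_sin_lt hκ0 hκ1 t)
  exact Real.sin_arcsin h.1.le h.2.le

/-- By the triple-angle formula 4c³ - 3c = cos 2θ = 1 - 2κ² sin² t. -/
lemma cubic_cosTwoThirds {κ : ℝ} (hκ0 : 0 < κ) (hκ1 : κ < 1) (t : ℝ) :
    4 * cosTwoThirds κ t ^ 3 - 3 * cosTwoThirds κ t - (1 - 2 * κ ^ 2) =
      2 * κ ^ 2 * Real.cos t ^ 2 := by
  rw [cosTwoThirds, ← Real.cos_three_mul,
    show 3 * (2 * Real.arcsin (κ * Real.sin t) / 3) = 2 * Real.arcsin (κ * Real.sin t) by ring,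
    Real.cos_two_mul, Real.cos_sq', sin_arcsin_mul_sin hκ0 hκ1]
  linear_combination (-2 * κ ^ 2) * Real.sin_sq_add_cos_sq t

lemma half_lt_cosTwoThirds {κ : ℝ} (hκ0 : 0 < κ) (hκ1 : κ < 1) (t : ℝ) : 1 / 2 < cosTwoThirds κ t := by
  obtain ⟨h1, h2⟩ := arcsin_mem hκ0 hκ1 t
  rw [← Real.cos_pi_div_three, cosTwoThirds, ← Real.cos_abs (2 * _ / 3)]
  refine Real.cos_lt_cos_of_nonneg_of_le_pi (abs_nonneg _) (by linarith [Real.pi_pos]) ?_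
  rw [abs_lt]
  constructor <;> linarith

lemma arcsin_pos {κ : ℝ} (hκ0 : 0 < κ) {t : ℝ} (ht : t ∈ Set.Ioc 0 (Real.pi / 2)) :
    0 < Real.arcsin (κ * Real.sin t) :=
  Real.arcsin_pos.mpr (mul_pos hκ0 (Real.sin_pos_of_pos_of_lt_pi ht.1
    (by linarith [ht.2, Real.pi_pos])))

lemma sin_two_thirds_pos {κ : ℝ} (hκ0 : 0 < κ) (hκ1 : κ < 1) {t : ℝ} (ht : t ∈ Set.Ioc 0 (Real.pi / 2)) :
    0 < Real.sin (2 * Real.arcsin (κ * Real.sin t) / 3) := by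
  have h1 := arcsin_pos hκ0 ht
  exact Real.sin_pos_of_pos_of_lt_pi (by positivity)
    (by linarith [(arcsin_mem hκ0 hκ1 t).2])

lemma one_sub_cosTwoThirds_sq (κ t : ℝ) :
    1 - cosTwoThirds κ t ^ 2 = Real.sin (2 * Real.arcsin (κ * Real.sin t) / 3) ^ 2 := by
  rw [cosTwoThirds, Real.sin_sq]

lemma continuous_cosTwoThirds {κ : ℝ} : Continuous (cosTwoThirds κ) := by
  unfold cosTwoThirds
  fun_prop

lemma hasDerivAt_cosTwoThirds {κ : ℝ} (hκ0 : 0 < κ) (hκ1 : κ < 1) (t : ℝ) :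
    HasDerivAt (cosTwoThirds κ)
      (-(2 / 3) * Real.sin (2 * Real.arcsin (κ * Real.sin t) / 3) * (κ * Real.cos t) /
        Real.cos (Real.arcsin (κ * Real.sin t))) t := by
  have h := abs_lt.mp (abs_mul_sin_lt hκ0 hκ1 t)
  have h1 := (Real.hasDerivAt_arcsin h.1.ne' h.2.ne).comp t ((Real.hasDerivAt_sin t).const_mul κ)
  have h2 := ((h1.const_mul 2).div_const 3).cos
  convert! h2 using 1
  rw [Real.cos_arcsin]
  simp only [Function.comp]
  ring

lemma cos_mul_hypergeometric {κ : ℝ} (hκ0 : 0 < κ) (hκ1 : κ < 1) (t : ℝ) :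
    Real.cos (Real.arcsin (κ * Real.sin t)) *
      ordinaryHypergeometric (1 / 6 : ℝ) (5 / 6 : ℝ) (1 / 2 : ℝ) (κ ^ 2 * Real.sin t ^ 2) =
    cosTwoThirds κ t := by
  have := cos_mul_ordinaryHypergeometric_sin_sq (arcsin_mem hκ0 hκ1 t)
  rwa [sin_arcsin_mul_sin hκ0 hκ1, mul_pow] at this

lemma continuous_hypergeometric {κ : ℝ} (hκ0 : 0 < κ) (hκ1 : κ < 1) : Continuous fun t : ℝ =>
    ordinaryHypergeometric (1 / 6 : ℝ) (5 / 6 : ℝ) (1 / 2 : ℝ) (κ ^ 2 * Real.sin t ^ 2) := by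
  have hpos : ∀ t, Real.cos (Real.arcsin (κ * Real.sin t)) ≠ 0 := fun t =>
    (Real.cos_pos_of_mem_Ioo (arcsin_mem hκ0 hκ1 t)).ne'
  have : (fun t : ℝ => ordinaryHypergeometric (1 / 6 : ℝ) (5 / 6 : ℝ) (1 / 2 : ℝ)
      (κ ^ 2 * Real.sin t ^ 2)) =
      fun t => cosTwoThirds κ t / Real.cos (Real.arcsin (κ * Real.sin t)) := by
    ext t
    rw [eq_div_iff (hpos t), mul_comm, cos_mul_hypergeometric hκ0 hκ1]
  rw [this]
  exact continuous_cosTwoThirds.div (by fun_prop) hpos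

/-- If `y` decreases from `+∞` on `(0, ω]`, satisfies `y'² = 4 y³ - 3 y - (1 - 2 κ²)` and is
stationary at `ω`, then `ω = √(2 / 3) K`. -/
lemma sqrt_mul_K_eq {κ : ℝ} (hκ0 : 0 < κ) (hκ1 : κ < 1) {y v : ℝ → ℝ} {ω : ℝ} (hω : 0 < ω)
    (hd : ∀ x ∈ Set.Ioc 0 ω, HasDerivAt y (v x) x) (hv : ∀ x ∈ Set.Ioo 0 ω, v x < 0)
    (hvω : v ω = 0) (hlim : Tendsto y (𝓝[>] 0) atTop)
    (hode : ∀ x ∈ Set.Ioc 0 ω, v x ^ 2 = 4 * y x ^ 3 - 3 * y x - (1 - 2 * κ ^ 2)) :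
    √(2 / 3) * K κ = ω := by
  obtain ⟨I, hI, hI0, hIω⟩ := exists_inverse_of_deriv_neg hω hd hv hlim
  set m := 1 - 2 * κ ^ 2 with hm
  set e := y ω with he
  have hPe : 4 * e ^ 3 - 3 * e - m = 0 := by rw [← hode ω ⟨hω, le_rfl⟩, hvω]; norm_num
  have hPpos : ∀ x, e < x → 0 < 4 * x ^ 3 - 3 * x - m := by
    intro x hx
    obtain ⟨h1, h2, -⟩ := hI x hx
    have h3 := hode _ ⟨h1.1, h1.2.le⟩
    rw [h2] at h3
    rw [← h3]
    exact sq_pos_of_neg (hv _ h1)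
  have hm1 : m < 1 := by rw [hm]; nlinarith
  have hm2 : -1 < m := by rw [hm]; nlinarith
  -- P is positive beyond e, while P(1/2) = -1 - m < 0.
  have he2 : 1 / 2 ≤ e := by
    by_contra! h
    have := hPpos _ h
    norm_num at this
    linarith
  have hfac : ∀ c, 1 / 2 < c → 0 < 4 * (c ^ 2 + c * e + e ^ 2) - 3 := fun c hc => by nlinarith
  have hce : ∀ c, (c - e) * (4 * (c ^ 2 + c * e + e ^ 2) - 3) = 4 * c ^ 3 - 3 * c - m := fun c => by
    linear_combination -hPe
  set c := cosTwoThirds κ with hc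
  set X : ℝ → ℝ := fun t => (c t ^ 3 - m) / (3 * (1 - c t ^ 2)) with hX
  have hc1 : ∀ t ∈ Set.Ioc 0 (Real.pi / 2), 0 < 1 - c t ^ 2 := by
    intro t ht
    rw [hc, one_sub_cosTwoThirds_sq]
    exact pow_pos (sin_two_thirds_pos hκ0 hκ1 ht) 2
  have hXe : ∀ t ∈ Set.Ioo 0 (Real.pi / 2), e < X t := by
    intro t ht
    have h1 := half_lt_cosTwoThirds hκ0 hκ1 t
    have hcos := Real.cos_pos_of_mem_Ioo ⟨by linarith [ht.1, Real.pi_pos], ht.2⟩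
    have h2 : 0 < c t - e := by
      refine pos_of_mul_pos_left ?_ (hfac _ h1).le
      rw [← hc, hce, hm, hc, cubic_cosTwoThirds hκ0 hκ1]
      positivity
    have h3 := hc1 t ⟨ht.1, ht.2.le⟩
    simp only [hX]
    rw [cubic_map_eq_root_add h3.ne' hPe]
    have h4 : 0 < c t + 2 * e := by rw [← hc] at h1; linarith
    have : 0 < (c t - e) * (c t + 2 * e) ^ 2 / (3 * (1 - c t ^ 2)) := by positivity
    linarith
  have hderiv : ∀ t ∈ Set.Ioo 0 (Real.pi / 2), HasDerivAt (fun t => I (X t))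
      (√(2 / 3) * ordinaryHypergeometric (1 / 6 : ℝ) (5 / 6 : ℝ) (1 / 2 : ℝ)
        (κ ^ 2 * Real.sin t ^ 2)) t := by
    intro t ht
    have htc : t ∈ Set.Ioc 0 (Real.pi / 2) := ⟨ht.1, ht.2.le⟩
    obtain ⟨h1, h2, h3⟩ := hI (X t) (hXe t ht)
    have hdX := (hasDerivAt_cubic_map (m := m) (hc1 t htc).ne').comp t (hasDerivAt_cosTwoThirds hκ0 hκ1 t)
    convert! h3.comp t hdX using 1
    have hcF := cos_mul_hypergeometric hκ0 hκ1 t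
    rw [← hc] at hcF
    have hcosθ := Real.cos_pos_of_mem_Ioo (arcsin_mem hκ0 hκ1 t)
    have hcos := Real.cos_pos_of_mem_Ioo ⟨by linarith [ht.1, Real.pi_pos], ht.2⟩
    have hσ := sin_two_thirds_pos hκ0 hκ1 htc
    have hcσ : 1 - c t ^ 2 = _ := one_sub_cosTwoThirds_sq κ t
    have hP : 4 * c t ^ 3 - 3 * c t - m = _ := cubic_cosTwoThirds hκ0 hκ1 t
    have hhalf : 1 / 2 < c t := half_lt_cosTwoThirds hκ0 hκ1 t
    have hv2 : v (I (X t)) ^ 2 = (4 * c t ^ 3 - 3 * c t - m) *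
        (c t ^ 3 - 3 * c t + 2 * m) ^ 2 / (27 * (1 - c t ^ 2) ^ 3) := by
      rw [hode _ ⟨h1.1, h1.2.le⟩, h2, ← cubic_map_comp_eq (hc1 t htc).ne']
    have hvneg := hv _ h1
    -- This sign, together with v < 0, selects the square root when V is recovered from V².
    have hS : c t ^ 3 - 3 * c t + 2 * m < 0 := by
      have e1 : c t ^ 3 - 3 * c t + 2 * m =
          -(9 * c t * (1 - c t ^ 2)) - 2 * (4 * c t ^ 3 - 3 * c t - m) := by ring
      have e2 : 0 < c t * (1 - c t ^ 2) := mul_pos (by linarith) (hc1 t htc)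
      have e3 : 0 < 2 * κ ^ 2 * Real.cos t ^ 2 := by positivity
      rw [e1, hP]
      linarith
    rw [hP, hcσ] at hv2
    rw [hcσ]
    generalize v (I (X t)) = V at *
    generalize Real.sin (2 * Real.arcsin (κ * Real.sin t) / 3) = σ at *
    generalize Real.cos (Real.arcsin (κ * Real.sin t)) = C at *
    generalize ordinaryHypergeometric (1 / 6 : ℝ) (5 / 6 : ℝ) (1 / 2 : ℝ)
      (κ ^ 2 * Real.sin t ^ 2) = F at *
    generalize Real.cos t = D at *
    rw [← hcF]
    rw [← hcF] at hS hv2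
    have hr : √(2 / 3) ^ 2 = (2 / 3 : ℝ) := Real.sq_sqrt (by norm_num)
    have hr0 : (0 : ℝ) < √(2 / 3) := by positivity
    generalize √(2 / 3 : ℝ) = r at *
    set S := (C * F) ^ 3 - 3 * (C * F) + 2 * m with hSdef
    have hV : V = r / 3 * S * κ * D / σ ^ 3 := by
      have hneg : r / 3 * S * κ * D / σ ^ 3 < 0 := by
        have : 0 < r / 3 * -S * κ * D / σ ^ 3 := by
          have : 0 < -S := by linarith
          positivity
        have e1 : r / 3 * -S * κ * D / σ ^ 3 = -(r / 3 * S * κ * D / σ ^ 3) := by ring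
        linarith
      have hsq : V ^ 2 = (r / 3 * S * κ * D / σ ^ 3) ^ 2 := by
        rw [hv2]
        field_simp
        rw [hr]
        ring
      rcases sq_eq_sq_iff_eq_or_eq_neg.mp hsq with h | h
      · exact h
      · linarith
    rw [hV]
    have hS0 : S ≠ 0 := hS.ne
    field_simp
    linear_combination (3 * F) * hr
  have hXtop : Tendsto X (𝓝[>] 0) atTop := by
    have hc0 : c 0 = 1 := by simp [hc, cosTwoThirds]
    have hcc : Tendsto c (𝓝[>] 0) (𝓝 1) := by
      have := (continuous_cosTwoThirds (κ := κ)).continuousAt (x := 0)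
      rw [ContinuousAt, ← hc, hc0] at this
      exact this.mono_left nhdsWithin_le_nhds
    have hnum : Tendsto (fun t => c t ^ 3 - m) (𝓝[>] 0) (𝓝 (1 - m)) := by
      simpa using (hcc.pow 3).sub_const m
    have hden : Tendsto (fun t => 3 * (1 - c t ^ 2)) (𝓝[>] 0) (𝓝[>] 0) := by
      refine tendsto_nhdsWithin_iff.mpr ⟨by simpa using ((hcc.pow 2).const_sub 1).const_mul 3, ?_⟩
      filter_upwards [Ioc_mem_nhdsGT (show (0 : ℝ) < Real.pi / 2 by positivity)] with t ht
      have := hc1 t ht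
      exact Set.mem_Ioi.mpr (by positivity)
    have := (hden.inv_tendsto_nhdsGT_zero).atTop_mul_pos (show 0 < 1 - m by linarith) hnum
    refine this.congr fun t => ?_
    simp only [hX, Pi.inv_apply]
    rw [div_eq_mul_inv, mul_comm]
  have hXend : Tendsto X (𝓝[<] (Real.pi / 2)) (𝓝[>] e) := by
    refine tendsto_nhdsWithin_iff.mpr ⟨?_, ?_⟩
    · have hmem : Real.pi / 2 ∈ Set.Ioc 0 (Real.pi / 2) := ⟨by positivity, le_rfl⟩
      have hcend : c (Real.pi / 2) = e := by
        have h1 := hce (c (Real.pi / 2))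
        have h2 : 4 * c (Real.pi / 2) ^ 3 - 3 * c (Real.pi / 2) - m = _ :=
          cubic_cosTwoThirds hκ0 hκ1 (Real.pi / 2)
        rw [h2, Real.cos_pi_div_two] at h1
        have h3 : c (Real.pi / 2) - e = 0 :=
          (mul_eq_zero.mp (h1.trans (by ring))).resolve_right
            (hfac _ (half_lt_cosTwoThirds hκ0 hκ1 _)).ne'
        linarith
      have hXe' : X (Real.pi / 2) = e := by
        simp only [hX]
        rw [cubic_map_eq_root_add (hc1 _ hmem).ne' hPe, hcend]
        simp
      have hXc : ContinuousAt X (Real.pi / 2) := by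
        have hcc : ContinuousAt c (Real.pi / 2) := continuous_cosTwoThirds.continuousAt
        exact ((hcc.pow 3).sub continuousAt_const).div
          (continuousAt_const.mul (continuousAt_const.sub (hcc.pow 2)))
          (by have := hc1 _ hmem; positivity)
      have := hXc.tendsto
      rw [hXe'] at this
      exact this.mono_left nhdsWithin_le_nhds
    · filter_upwards [Ioo_mem_nhdsLT (show (0 : ℝ) < Real.pi / 2 by positivity)] with t ht
      exact hXe t ht
  -- Only one-sided limits are available at the endpoints: I(X) tends to 0 as t → 0, where X → +∞,
  -- and to ω as t → π/2, where X → e.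
  have hint := intervalIntegral.integral_eq_sub_of_hasDerivAt_of_tendsto
    (show (0 : ℝ) < Real.pi / 2 by positivity) hderiv
    ((continuous_const.mul (continuous_hypergeometric hκ0 hκ1)).intervalIntegrable _ _)
    (hI0.comp hXtop) (hIω.comp hXend)
  rw [intervalIntegral.integral_const_mul, sub_zero] at hint
  exact hint

end SignatureSix

/-! ### Assembly of the theorem -/

open PeriodPair in
theorem theorem6 (κ : ℝ) (hκ0 : 0 < κ) (hκ1 : κ < 1) :
    (∃! p : ℂ → ℂ, SignatureSix.IsWeierstrassFunction 3 (1 - 2 * (κ : ℂ) ^ 2) p) ∧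
    ∀ p : ℂ → ℂ, SignatureSix.IsWeierstrassFunction 3 (1 - 2 * (κ : ℂ) ^ 2) p →
      (∃ ω ω' : ℝ, SignatureSix.HasRectangularHalfPeriods p ω ω') ∧
      ∀ ω ω' : ℝ, SignatureSix.HasRectangularHalfPeriods p ω ω' →
        SignatureSix.K κ = Real.sqrt (3 / 2) * ω := by
  obtain ⟨a, a', ha, ha', h2, h3⟩ := exists_rectangular_invariants (m := 1 - 2 * κ ^ 2)
    (by rw [abs_lt]; constructor <;> nlinarith)
  push_cast at h3
  have huniq : ∀ p, SignatureSix.IsWeierstrassFunction 3 (1 - 2 * (κ : ℂ) ^ 2) p →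
      p = (rectangular a a' ha ha').weierstrassP := by
    rintro p ⟨L, hL2, hL3, rfl⟩
    exact weierstrassP_eq_of_lattice_eq
      (lattice_eq_of_g₂_eq_of_g₃_eq (hL2.trans h2.symm) (hL3.trans h3.symm))
  have hmem : ∀ {ω ω' : ℝ} (hω : 0 < ω) (hω' : 0 < ω') (w : ℂ),
      w ∈ (rectangular ω ω' hω hω').lattice ↔
      ∃ m n : ℤ, w = 2 * (m : ℂ) * (ω : ℂ) + 2 * (n : ℂ) * (Complex.I * (ω' : ℂ)) := by
    intro ω ω' hω hω' w
    rw [mem_lattice]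
    refine exists₂_congr fun m n => ?_
    rw [eq_comm, rectangular_ω₁, rectangular_ω₂]
    ring_nf
  refine ⟨⟨_, ⟨_, h2, h3, rfl⟩, huniq⟩, fun p hp => ⟨⟨a, a', ha, ha', fun w => ?_⟩, ?_⟩⟩
  · rw [huniq p hp, periodic_weierstrassP_iff, hmem]
  · rintro ω ω' ⟨hω, hω', hper⟩
    rw [huniq p hp] at hper
    -- The given half-periods span the same lattice as a, a', so the invariants carry over and the
    -- integral formula applies to ω directly.
    have hlat : (rectangular a a' ha ha').lattice = (rectangular ω ω' hω hω').lattice := by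
      ext w
      rw [← periodic_weierstrassP_iff, hper, hmem]
    have hG := G_eq_of_lattice_eq hlat
    have h2' : (rectangular ω ω' hω hω').g₂ = 3 := by rw [← h2, g₂, g₂, hG]
    have h3' : (rectangular ω ω' hω hω').g₃ = 1 - 2 * (κ : ℂ) ^ 2 := by rw [← h3, g₃, g₃, hG]
    have hre : (rectangular ω ω' hω hω').g₃.re = 1 - 2 * κ ^ 2 := by
      rw [h3']
      norm_cast
    have key := SignatureSix.sqrt_mul_K_eq hκ0 hκ1 hω
      (fun x hx => hasDerivAt_re_weierstrassP_rectangular hω hω' hx.1 (by linarith [hx.2]))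
      (fun x hx => re_derivWeierstrassP_rectangular_neg hω hω' hx.1 hx.2)
      (re_derivWeierstrassP_rectangular_half hω hω')
      (tendsto_re_weierstrassP_rectangular hω hω')
      (fun x hx => by
        rw [re_derivWeierstrassP_rectangular_sq hω hω' hx.1 (by linarith [hx.2]), h2', hre]
        norm_num)
    rw [← key, ← mul_assoc, ← Real.sqrt_mul (by norm_num)]
    norm_num
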